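/- Consider an implicit ordinary differential equation $F(x,y,p)=0$, $p=\frac{dy}{dx}$, with $F$ smooth ($C^\infty$), given on an open subset of $\mathbb R^2\times\mathbb P^1(\mathbb R)$; here $p=b/a$ is the slope of the line $[a:b]\in\mathbb P^1(\mathbb R)$ (with $p=\infty$ for $[0:1]$), and near points with $p=\infty$ the equation and the conditions below are read in homogeneous coordinates $[a:b]$. Let $M=\{F=0\}$ be the corresponding surface, $\pi:M\to\mathbb R^2$, $(x,y,p)\mapsto(x,y)$, the projection, and $C=\{F=F_p=0\}$ the criminant. Suppose that $M$ is smooth, i.e. $\operatorname{grad}F\neq 0$ at every point of $M$; that $C$ is a smooth (embedded) curve which is Legendrian, i.e. its tangent lines lie in the contact planes $dy-p\,dx=0$; and that $\pi$ has a fold singularity at a point $m\in C$, i.e. in suitable smooth local coordinates on $M$ centred at $m$ and on $\mathbb R^2$ centred at $\pi(m)$ it has the form $(u,v)\mapsto(u,v^2)$. Then near $m$ the equation $F=0$ is equivalent to $$p^2=y$$ near $(x,y,p)=(0,0,0)$: there is a smooth diffeomorphism $\varphi:\tilde U\to U$ between open neighbourhoods $\tilde U$ of $(0,0)$ and $U$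 of $\pi(m)$ in $\mathbb R^2$, with $\varphi(0,0)=\pi(m)$, whose induced action $(z,\ell)\mapsto(\varphi(z),d\varphi_z\ell)$ on points with directions takes $(0,0,0)$ to $m$ and takes the surface $p^2=y$ in a neighbourhood of $(0,0,0)$ onto the surface $M$ in a neighbourhood of $m$. -/

import Mathlib

open scoped ContDiff Topology LinearAlgebra.Projectivization

/-- The plane `ℝ²` with coordinates `(x, y)`; also its tangent spaces, with coordinates
`(dx, dy) = (a, b)`. -/
abbrev Plane : Type := ℝ × ℝ

/-- The real projective line carries the quotient topology from `ℝ² ∖ {0}`. -/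
instance projectiveLineTopology : TopologicalSpace (ℙ ℝ Plane) :=
  inferInstanceAs (TopologicalSpace (Quotient (projectivizationSetoid ℝ Plane)))

/-- The space `ℝ² × P¹(ℝ)` of points `(x, y, p)`; the point `[a : b]` of the projective line is
the slope `p = dy/dx = b/a`, with `p = ∞` for `[0 : 1]`. -/
abbrev ContactElement : Type := Plane × ℙ ℝ Plane

/-- `((x, y), (a, b))` are homogeneous coordinates of the contact element `m`:
`(a, b) ≠ 0` and `m = (x, y, [a : b])`. -/
def Represents (w : Plane × Plane) (m : ContactElement) : Prop :=
  m.1 = w.1 ∧ ∃ h : w.2 ≠ 0, m.2 = Projectivization.mk ℝ w.2 h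

/-- An implicit ODE `F = 0` on an open subset of `ℝ² × P¹(ℝ)`, where `F` is smooth and is written
in homogeneous coordinates `((x, y), (a, b))`, `p = b/a`: it is a smooth function, homogeneous of
some degree in `(a, b)`. An equation `f (x, y, p) = 0` in the affine coordinate `p` is the case of
degree `0` (see `ImplicitODE.ofFunction`); a polynomial equation of degree `d` in `p` over the
whole projective line is the case of degree `d`. -/
structure ImplicitODE where
  dom : Set (Plane × Plane)
  isOpen_dom : IsOpen dom
  ne_zero_of_mem : ∀ w ∈ dom, w.2 ≠ 0
  smul_mem : ∀ w ∈ dom, ∀ c : ℝ, c ≠ 0 → (w.1, c • w.2) ∈ dom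
  F : Plane × Plane → ℝ
  smooth : ContDiffOn ℝ ∞ F dom
  deg : ℤ
  homogeneous : ∀ w ∈ dom, ∀ c : ℝ, c ≠ 0 → F (w.1, c • w.2) = c ^ deg * F w

namespace ImplicitODE

/-- The implicit ODE `f (x, y, p) = 0`, where `p = dy/dx` is the affine coordinate and `f` is
smooth on an open set `W` of the space with coordinates `(x, y, p)`. -/
noncomputable def ofFunction (f : ℝ × ℝ × ℝ → ℝ) (W : Set (ℝ × ℝ × ℝ)) (hW : IsOpen W)
    (hf : ContDiffOn ℝ ∞ f W) : ImplicitODE where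
  dom := {w | w.2.1 ≠ 0 ∧ (w.1.1, w.1.2, w.2.2 / w.2.1) ∈ W}
  isOpen_dom := by
    have h1 : IsOpen {w : Plane × Plane | w.2.1 ≠ 0} :=
      isOpen_ne_fun (by fun_prop) continuous_const
    have h2 : ContinuousOn (fun w : Plane × Plane => (w.1.1, w.1.2, w.2.2 / w.2.1))
        {w : Plane × Plane | w.2.1 ≠ 0} := by
      have h3 : ContinuousOn (fun w : Plane × Plane => w.2.2 / w.2.1)
          {w : Plane × Plane | w.2.1 ≠ 0} :=
        ContinuousOn.div (by fun_prop) (by fun_prop) (fun w hw => hw)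
      fun_prop
    exact h2.isOpen_inter_preimage h1 hW
  ne_zero_of_mem := by
    rintro w ⟨h, -⟩ h0
    exact h (by rw [h0]; rfl)
  smul_mem := by
    rintro w ⟨h, hw⟩ c hc
    refine ⟨mul_ne_zero hc h, ?_⟩
    simpa [mul_div_mul_left _ _ hc] using hw
  F := fun w => f (w.1.1, w.1.2, w.2.2 / w.2.1)
  smooth := by
    have h3 : ContDiffOn ℝ ∞ (fun w : Plane × Plane => w.2.2 / w.2.1)
        {w | w.2.1 ≠ 0 ∧ (w.1.1, w.1.2, w.2.2 / w.2.1) ∈ W} :=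
      ContDiffOn.div (by fun_prop) (by fun_prop) (fun w hw => hw.1)
    exact hf.comp (t := W) (f := fun w : Plane × Plane => (w.1.1, w.1.2, w.2.2 / w.2.1))
      (by fun_prop) (fun w hw => hw.2)
  deg := 0
  homogeneous := by
    rintro w - c hc
    simp [mul_div_mul_left _ _ hc]

/-- The surface `M = {F = 0}` in `ℝ² × P¹(ℝ)`. -/
def surface (E : ImplicitODE) : Set ContactElement :=
  {m | ∃ w ∈ E.dom, Represents w m ∧ E.F w = 0}

/-- The surface `M` is smooth: `grad F ≠ 0` at every point where `F = 0`. -/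
def IsSmoothSurface (E : ImplicitODE) : Prop :=
  ∀ w ∈ E.dom, E.F w = 0 → fderiv ℝ E.F w ≠ 0

/-- The criminant `C = {F = F_p = 0}`: the derivative of `F` along the projective line vanishes. -/
def criminant (E : ImplicitODE) : Set ContactElement :=
  {m | ∃ w ∈ E.dom, Represents w m ∧ E.F w = 0 ∧ ∀ v : Plane, fderiv ℝ E.F w (0, v) = 0}

end ImplicitODE

/-- `γ` is a regular smooth parametrization, by the open neighbourhood `N` of `0` in `X`, of a
neighbourhood of `m` in `S ⊆ ℝ² × P¹(ℝ)`: with smooth homogeneous coordinates `w`, it is an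
immersion (the only vectors that the differential of `w` sends to a multiple of the direction in
which `w` represents the same contact element are zero) and a topological embedding whose image is
open in `S`. -/
def IsLocalParametrization {X : Type*} [NormedAddCommGroup X] [NormedSpace ℝ X]
    (S : Set ContactElement) (m : ContactElement) (N : Set X) (γ : X → ContactElement) : Prop :=
  IsOpen N ∧ (0 : X) ∈ N ∧ γ 0 = m ∧
  (∃ w : X → Plane × Plane, ContDiffOn ℝ ∞ w N ∧ (∀ t ∈ N, Represents (w t) (γ t)) ∧
    ∀ t ∈ N, ∀ τ : X, (∃ c : ℝ, fderiv ℝ w t τ = (0, c • (w t).2)) → τ = 0) ∧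
  Topology.IsEmbedding (N.domRestrict γ) ∧
  ∃ V : Set ContactElement, IsOpen V ∧ γ '' N = S ∩ V

/-- `C` is a smooth (embedded) curve in `ℝ² × P¹(ℝ)`. -/
def IsSmoothCurve (C : Set ContactElement) : Prop :=
  ∀ m ∈ C, ∃ (N : Set ℝ) (γ : ℝ → ContactElement), IsLocalParametrization C m N γ

/-- `C` is Legendrian: every velocity vector of a smooth path in `C` lies in the contact plane
`dy - p dx = 0`, that is, `a dy - b dx = 0`. -/
def IsLegendrian (C : Set ContactElement) : Prop :=
  ∀ w : ℝ → Plane × Plane, ContDiffAt ℝ ∞ w 0 →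
    (∀ᶠ t in 𝓝 (0 : ℝ), ∃ m ∈ C, Represents (w t) m) →
    (w 0).2.1 * (deriv w 0).1.2 - (w 0).2.2 * (deriv w 0).1.1 = 0

/-- `φ` is a smooth diffeomorphism of an open subset of the plane onto another one. -/
def IsSmoothDiffeo (φ : OpenPartialHomeomorph Plane Plane) : Prop :=
  ContDiffOn ℝ ∞ φ φ.source ∧ ContDiffOn ℝ ∞ φ.symm φ.target

/-- The projection `π : M → ℝ²` has a fold at `m`: in suitable local coordinates `(u, v)` on `M`
centred at `m`, and suitable local coordinates of the plane centred at `π m`, it is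
`(u, v) ↦ (u, v²)`. -/
def HasFoldAt (M : Set ContactElement) (m : ContactElement) : Prop :=
  ∃ (N : Set (ℝ × ℝ)) (γ : ℝ × ℝ → ContactElement) (k : OpenPartialHomeomorph Plane Plane),
    IsLocalParametrization M m N γ ∧ IsSmoothDiffeo k ∧
    ∀ t ∈ N, (γ t).1 ∈ k.source ∧ k (γ t).1 = (t.1, t.2 ^ 2)

open Classical in
/-- The action of a local diffeomorphism of the plane on contact elements,
`(z, ℓ) ↦ (φ z, dφ_z ℓ)`. (The value where `dφ_z` is not invertible plays no role.) -/
noncomputable def prolong (φ : Plane → Plane) (m : ContactElement) : ContactElement :=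
  (φ m.1,
    if h : Function.Injective (fderiv ℝ φ m.1 : Plane →ₗ[ℝ] Plane) then
      Projectivization.map (fderiv ℝ φ m.1 : Plane →ₗ[ℝ] Plane) h m.2
    else m.2)

/-- The equation `E` near its point `m` is equivalent to the equation `E'` near its point `m'`:
some diffeomorphism `φ` of a neighbourhood of `π m'` onto a neighbourhood of `π m`, with
`φ (π m') = π m`, carries `m'` to `m` and the surface of `E'` near `m'` to the surface of `E`
near `m`. -/
def ImplicitODE.LocallyEquivalent (E : ImplicitODE) (m : ContactElement)
    (E' : ImplicitODE) (m' : ContactElement) : Prop :=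
  ∃ φ : OpenPartialHomeomorph Plane Plane, IsSmoothDiffeo φ ∧
    m'.1 ∈ φ.source ∧ φ m'.1 = m.1 ∧ prolong φ m' = m ∧
    ∀ᶠ q in 𝓝 m', (q ∈ E'.surface ↔ prolong φ q ∈ E.surface)

/-- The equation `p² = y`. -/
noncomputable def quadraticLegendrianODE : ImplicitODE :=
  ImplicitODE.ofFunction (fun q => q.2.2 ^ 2 - q.2.1) Set.univ isOpen_univ
    (ContDiff.contDiffOn (by fun_prop))

/-- The point `(x, y, p) = (0, 0, 0)`. -/
noncomputable def originElement : ContactElement :=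
  ((0, 0), Projectivization.mk ℝ (1, 0) (by simp))

open MeasureTheory Function

/-! In fold coordinates the surface projects by (u, v) ↦ (u, v²), and the equation attaches to (u,
v) a line at the point (u, v²). The fold line v = 0 lies in the criminant. Since the criminant is
Legendrian, the lines over it are tangent to the curve y = 0, so the slope is v q(u, v) by
Hadamard's lemma. The surface is immersed in the space of contact elements, so the slope has nonzero
v-derivative at the origin and q(0) ≠ 0. Hence near the origin the lines are spanned by the images
under the fold of a smooth field R ∂ₓ + ∂ᵥ with R(0) ≠ 0 (`FoldLift.exists_direction_proportional`).

This field has a first integral c with c(x, 0) = x. Write c = X − 2B with X even and B odd in v.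
Along the field dX = 2 dB, so Y = B² satisfies dY = B dX. Thus in the coordinates (X, Y) the slope
is B and its square is Y. Being even in v, X and Y are smooth functions of (x, v²) by Whitney's
theorem, so they are coordinates on the plane itself (`exists_fold_straightening`).

Three analytic facts are needed. Whitney's theorem with a parameter (`exists_contDiff_even_part`)
comes from Fourier inversion, once cos v is written as a function of v² of temperate growth.
Hadamard's lemma is an integral formula. The smooth flow (`exists_local_flow`) comes from the
inverse function theorem in a Banach space of curves. -/

theorem Function.HasTemperateGrowth.fderiv {E F : Type*} [NormedAddCommGroup E] [NormedSpace ℝ E]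
    [NormedAddCommGroup F] [NormedSpace ℝ F] {f : E → F} (hf : f.HasTemperateGrowth) :
    (_root_.fderiv ℝ f).HasTemperateGrowth := by
  refine ⟨hf.1.fderiv_right (by simp), fun n => ?_⟩
  obtain ⟨k, C, h⟩ := hf.2 (n + 1)
  refine ⟨k, C, fun x => ?_⟩
  rw [norm_iteratedFDeriv_fderiv]
  exact h x

/-! ### Smoothness of integrals depending on a parameter -/

section ParametricIntegral

variable {E Ω : Type} [NormedAddCommGroup E] [NormedSpace ℝ E]
  [NormedAddCommGroup Ω] [NormedSpace ℝ Ω] [MeasurableSpace Ω] [BorelSpace Ω]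
  [SecondCountableTopology Ω]
  {𝕜 : Type} [RCLike 𝕜] {μ : Measure Ω} {φ : Ω → 𝕜}

/-- Domination: for x in the unit ball around z, 1 + ‖(x, s)‖ ≤ (2 + ‖z‖)(1 + ‖s‖), so polynomial
bounds on the kernel become bounds in s alone, integrable against φ because all its moments are
finite. -/
theorem hasFDerivAt_integral_smul_of_hasTemperateGrowth {F : Type} [NormedAddCommGroup F]
    [NormedSpace ℝ F] [NormedSpace 𝕜 F] [SMulCommClass ℝ 𝕜 F]
    (hm : AEStronglyMeasurable φ μ) (hφ : ∀ k : ℕ, Integrable (fun s => (1 + ‖s‖) ^ k * ‖φ s‖) μ)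
    {K : E × Ω → F} (hK : K.HasTemperateGrowth) (z : E) :
    HasFDerivAt (fun z => ∫ s, φ s • K (z, s) ∂μ)
      (∫ s, φ s • (fderiv ℝ K (z, s) ∘L .inl ℝ E Ω) ∂μ) z := by
  have hc := hK.1.continuous
  have hc' : Continuous (fderiv ℝ K) := hK.fderiv.1.continuous
  have hd : Differentiable ℝ K := hK.1.differentiable (by simp)
  obtain ⟨k, C, hC⟩ := hK.2 0
  obtain ⟨k', C', hC'⟩ := hK.fderiv.2 0
  simp only [norm_iteratedFDeriv_zero] at hC hC'
  have hC0 : 0 ≤ C := by simpa using (norm_nonneg _).trans (hC 0)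
  have hC0' : 0 ≤ C' := by simpa using (norm_nonneg _).trans (hC' 0)
  have hpow : ∀ (j : ℕ) (x : E) (s : Ω), x ∈ Metric.ball z 1 →
      (1 + ‖(x, s)‖) ^ j ≤ (2 + ‖z‖) ^ j * (1 + ‖s‖) ^ j := by
    intro j x s hx
    rw [← mul_pow]
    gcongr
    have h1 : ‖x‖ ≤ ‖z‖ + 1 := by
      have := norm_sub_norm_le x z
      rw [Metric.mem_ball, dist_eq_norm] at hx
      linarith
    have h2 : ‖(x, s)‖ ≤ ‖x‖ + ‖s‖ := by
      rw [Prod.norm_mk]; exact max_le_add_of_nonneg (norm_nonneg _) (norm_nonneg _)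
    nlinarith [norm_nonneg z, norm_nonneg s, mul_nonneg (norm_nonneg z) (norm_nonneg s)]
  refine hasFDerivAt_integral_of_dominated_of_fderiv_le
    (F' := fun x s => φ s • (fderiv ℝ K (x, s) ∘L .inl ℝ E Ω))
    (bound := fun s => (C' * (2 + ‖z‖) ^ k') * ((1 + ‖s‖) ^ k' * ‖φ s‖))
    (Metric.ball_mem_nhds z one_pos) ?_ ?_ ?_ ?_ ?_ ?_
  · refine Filter.Eventually.of_forall fun x => hm.smul ?_
    exact (hc.comp (by fun_prop : Continuous fun s : Ω => (x, s))).aestronglyMeasurable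
  · refine Integrable.mono' ((hφ k).const_mul (C * (2 + ‖z‖) ^ k)) (hm.smul
      (hc.comp (by fun_prop : Continuous fun s : Ω => (z, s))).aestronglyMeasurable)
      (Filter.Eventually.of_forall fun s => ?_)
    rw [norm_smul]
    calc ‖φ s‖ * ‖K (z, s)‖ ≤ ‖φ s‖ * (C * ((2 + ‖z‖) ^ k * (1 + ‖s‖) ^ k)) := by
          gcongr
          exact (hC _).trans (by gcongr; exact hpow k z s (Metric.mem_ball_self one_pos))
      _ = _ := by ring
  · have : SecondCountableTopologyEither Ω (E →L[ℝ] F) := ⟨Or.inl inferInstance⟩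
    have h := hc'.comp (by fun_prop : Continuous fun s : Ω => (z, s))
    exact hm.smul (h.clm_comp continuous_const).aestronglyMeasurable
  · refine Filter.Eventually.of_forall fun s x hx => ?_
    rw [norm_smul]
    calc ‖φ s‖ * ‖fderiv ℝ K (x, s) ∘L .inl ℝ E Ω‖
        ≤ ‖φ s‖ * (C' * ((2 + ‖z‖) ^ k' * (1 + ‖s‖) ^ k')) := by
          gcongr
          calc _ ≤ ‖fderiv ℝ K (x, s)‖ * ‖ContinuousLinearMap.inl ℝ E Ω‖ :=
                ContinuousLinearMap.opNorm_comp_le _ _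
            _ ≤ ‖fderiv ℝ K (x, s)‖ * 1 := by
                gcongr
                exact ContinuousLinearMap.norm_inl_le_one ℝ E Ω
            _ ≤ _ := by
                rw [mul_one]
                exact (hC' _).trans (by gcongr; exact hpow k' x s hx)
      _ = _ := by ring
  · exact (hφ k').const_mul _
  · refine Filter.Eventually.of_forall fun s x _ => ?_
    have h := (hd (x, s)).hasFDerivAt.comp x
      (hasFDerivAt_prodMk_left (𝕜 := ℝ) x s)
    exact h.const_smul (φ s)

/-- The derivative is an integral of the same kind, whose kernel again has temperate growth but
takes values in a space of linear maps; hence the induction over all `F`. -/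
theorem contDiff_integral_smul_of_hasTemperateGrowth {F : Type} [NormedAddCommGroup F]
    [NormedSpace ℝ F] [NormedSpace 𝕜 F] [SMulCommClass ℝ 𝕜 F]
    (hm : AEStronglyMeasurable φ μ) (hφ : ∀ k : ℕ, Integrable (fun s => (1 + ‖s‖) ^ k * ‖φ s‖) μ)
    {K : E × Ω → F} (hK : K.HasTemperateGrowth) :
    ContDiff ℝ ∞ (fun z => ∫ s, φ s • K (z, s) ∂μ) := by
  rw [contDiff_infty]
  intro n
  induction n generalizing F with
  | zero =>
    rw [Nat.cast_zero, contDiff_zero, continuous_iff_continuousAt]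
    exact fun z => (hasFDerivAt_integral_smul_of_hasTemperateGrowth hm hφ hK z).continuousAt
  | succ n ih =>
    have h := hasFDerivAt_integral_smul_of_hasTemperateGrowth hm hφ hK
    rw [Nat.cast_succ, contDiff_succ_iff_fderiv]
    refine ⟨fun z => (h z).differentiableAt, by simp, ?_⟩
    rw [funext fun z => (h z).fderiv]
    refine ih (K := fun w => fderiv ℝ K w ∘L .inl ℝ E Ω) ?_
    exact (((ContinuousLinearMap.compL ℝ E (E × Ω) F).flip (.inl ℝ E Ω)).hasTemperateGrowth).comp
      hK.fderiv

end ParametricIntegral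

/-! ### The cosine as a function of temperate growth of the square -/

/-- The entire function `z ↦ cos √z`. -/
noncomputable def cosSqrt (z : ℂ) : ℂ := ∑' n : ℕ, (-1) ^ n * z ^ n / ((2 * n).factorial : ℂ)

theorem cosSqrt_sq (w : ℂ) : cosSqrt (w ^ 2) = Complex.cos w := by
  rw [← (Complex.hasSum_cos w).tsum_eq, cosSqrt]
  simp only [pow_mul]

theorem differentiable_cosSqrt : Differentiable ℂ cosSqrt := by
  intro z
  have h : DifferentiableOn ℂ cosSqrt (Metric.ball 0 (‖z‖ + 1)) := by
    refine Complex.differentiableOn_tsum_of_summable_norm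
      (Real.summable_pow_div_factorial (‖z‖ + 1)) (fun n => by fun_prop) Metric.isOpen_ball ?_
    intro n w hw
    rw [mem_ball_zero_iff] at hw
    rw [norm_div, norm_mul, norm_pow, norm_pow, norm_neg, norm_one, one_pow, one_mul,
      Complex.norm_natCast]
    gcongr
    lia
  exact h.differentiableAt (Metric.isOpen_ball.mem_nhds (by simp))

theorem Complex.norm_cos_le_exp_abs_im (w : ℂ) : ‖Complex.cos w‖ ≤ Real.exp |w.im| := by
  rw [Complex.cos, norm_div, Complex.norm_ofNat, div_le_iff₀ two_pos]
  refine (norm_add_le _ _).trans ?_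
  rw [Complex.norm_exp, Complex.norm_exp]
  have h1 : (w * I).re ≤ |w.im| := by simpa using neg_le_abs w.im
  have h2 : (-w * I).re ≤ |w.im| := by simpa using le_abs_self w.im
  linarith [Real.exp_le_exp.2 h1, Real.exp_le_exp.2 h2]

/-- If w² lies on the circle, then 2 (Im w)² = |w²| − Re w² ≤ (|s| + 1) − (s − 1) ≤ 4, as |s| ≤ s +
2. So the roots stay in a fixed horizontal strip, where cos is bounded. -/
theorem norm_cosSqrt_le {s : ℝ} (hs : -1 ≤ s) {z : ℂ} (hz : z ∈ Metric.sphere (s : ℂ) 1) :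
    ‖cosSqrt z‖ ≤ Real.exp 2 := by
  obtain ⟨w, rfl⟩ := IsAlgClosed.exists_pow_nat_eq z two_pos
  rw [cosSqrt_sq]
  refine (Complex.norm_cos_le_exp_abs_im w).trans (Real.exp_le_exp.2 ?_)
  rw [mem_sphere_iff_norm] at hz
  have h1 : |(w ^ 2 - s).re| ≤ 1 := (Complex.abs_re_le_norm _).trans hz.le
  have h2 : ‖w ^ 2‖ ≤ |s| + 1 := by
    have := norm_sub_norm_le (w ^ 2) (s : ℂ)
    rw [Complex.norm_real, Real.norm_eq_abs] at this
    linarith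
  rw [norm_pow, Complex.sq_norm, Complex.normSq_apply] at h2
  have h3 : (w ^ 2 - s).re = w.re * w.re - w.im * w.im - s := by simp [pow_two]
  rw [h3, abs_le] at h1
  have h4 : |s| ≤ s + 2 := abs_le.2 ⟨by linarith, by linarith⟩
  refine abs_le_of_sq_le_sq ?_ (by norm_num)
  nlinarith [h1.1, h2, h4]

theorem iteratedDeriv_comp_ofReal {f : ℂ → ℂ} (hf : Differentiable ℂ f) (n : ℕ) (s : ℝ) :
    iteratedDeriv n (fun t : ℝ => f t) s = iteratedDeriv n f s := by
  induction n generalizing s with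
  | zero => simp
  | succ n ih =>
    rw [iteratedDeriv_succ, iteratedDeriv_succ, funext ih]
    exact (((hf.contDiff (n := ∞)).differentiable_iteratedDeriv n
      (by exact_mod_cast WithTop.coe_lt_top _)) (s : ℂ)).hasDerivAt.comp_ofReal.deriv

theorem contDiff_cosSqrt_ofReal : ContDiff ℝ ∞ (fun s : ℝ => cosSqrt s) :=
  ((differentiable_cosSqrt.contDiff (n := ∞)).restrict_scalars ℝ).comp Complex.ofRealCLM.contDiff

/-- Cauchy's estimate on the unit circle around s; the bound is uniform in s. -/
theorem norm_iteratedFDeriv_cosSqrt_le (n : ℕ) {s : ℝ} (hs : -1 ≤ s) :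
    ‖iteratedFDeriv ℝ n (fun s : ℝ => cosSqrt s) s‖ ≤ n.factorial * Real.exp 2 := by
  rw [norm_iteratedFDeriv_eq_norm_iteratedDeriv, iteratedDeriv_comp_ofReal differentiable_cosSqrt]
  simpa using Complex.norm_iteratedDeriv_le_of_forall_mem_sphere_norm_le n one_pos
    (differentiable_cosSqrt.diffContOnCl) (fun z hz => norm_cosSqrt_le hs hz)

theorem Real.smoothTransition.hasTemperateGrowth_comp_add_one :
    (fun s : ℝ => Real.smoothTransition (s + 1)).HasTemperateGrowth := by
  have hc : ContDiff ℝ ∞ (fun s : ℝ => Real.smoothTransition (s + 1)) :=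
    Real.smoothTransition.contDiff.comp (by fun_prop)
  refine .of_fderiv (k := 0) (C := 1) ?_ (hc.differentiable (by simp)) ?_
  · refine HasCompactSupport.hasTemperateGrowth ?_ (hc.fderiv_right (by simp))
    refine HasCompactSupport.intro (K := Set.Icc (-1) 0) isCompact_Icc fun s hs => ?_
    rw [Set.mem_Icc, not_and_or, not_le, not_le] at hs
    rcases hs with hs | hs
    · have : (fun s : ℝ => Real.smoothTransition (s + 1)) =ᶠ[𝓝 s] fun _ => 0 := by
        filter_upwards [Iio_mem_nhds hs] with t ht
        exact Real.smoothTransition.zero_of_nonpos (by linarith [Set.mem_Iio.1 ht])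
      rw [this.fderiv_eq]; simp
    · have : (fun s : ℝ => Real.smoothTransition (s + 1)) =ᶠ[𝓝 s] fun _ => 1 := by
        filter_upwards [Ioi_mem_nhds hs] with t ht
        exact Real.smoothTransition.one_of_one_le (by linarith [Set.mem_Ioi.1 ht])
      rw [this.fderiv_eq]; simp
  · intro x
    rw [Real.norm_of_nonneg (Real.smoothTransition.nonneg _)]
    simpa using Real.smoothTransition.le_one _

/-- For negative s, cos √s = cosh √|s| is not of polynomial growth. Only s ≥ 0 matters, so the
function is cut off between −1 and 0; on the rest all derivatives are bounded. -/
theorem exists_hasTemperateGrowth_cos_eq_sq :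
    ∃ c : ℝ → ℂ, c.HasTemperateGrowth ∧ ∀ v : ℝ, c (v ^ 2) = Complex.cos v := by
  have ht := Real.smoothTransition.hasTemperateGrowth_comp_add_one
  refine ⟨fun s => Real.smoothTransition (s + 1) • cosSqrt s,
    ⟨ht.1.smul contDiff_cosSqrt_ofReal, fun n => ?_⟩, fun v => ?_⟩
  · obtain ⟨k, C, hC, h⟩ := ht.norm_iteratedFDeriv_le_uniform n
    refine ⟨k, ∑ i ∈ Finset.range (n + 1), n.choose i * C * ((n - i).factorial * Real.exp 2),
      fun s => ?_⟩
    by_cases hs : s < -1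
    · have h0 : (fun s : ℝ => Real.smoothTransition (s + 1) • cosSqrt s) =ᶠ[𝓝 s] fun _ => 0 := by
        filter_upwards [Iio_mem_nhds hs] with t ht
        rw [Real.smoothTransition.zero_of_nonpos (by linarith [Set.mem_Iio.1 ht]), zero_smul]
      rw [(h0.iteratedFDeriv ℝ n).eq_of_nhds]
      have h1 : ‖iteratedFDeriv ℝ n (fun _ : ℝ => (0 : ℂ)) s‖ = 0 := by
        rw [iteratedFDeriv_fun_zero]; simp
      rw [h1]
      positivity
    · rw [not_lt] at hs
      refine (norm_iteratedFDeriv_smul_le ht.1 contDiff_cosSqrt_ofReal s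
        (mod_cast le_top)).trans ?_
      rw [Finset.sum_mul]
      refine Finset.sum_le_sum fun i hi => ?_
      calc _ ≤ n.choose i * (C * (1 + ‖s‖) ^ k) * ((n - i).factorial * Real.exp 2) := by
            gcongr
            · exact h i (Finset.mem_range_succ_iff.1 hi) s
            · exact norm_iteratedFDeriv_cosSqrt_le _ hs
        _ = _ := by ring
  · have h1 := Real.smoothTransition.one_of_one_le (x := v ^ 2 + 1) (by nlinarith [sq_nonneg v])
    simp only [h1, one_smul, Complex.ofReal_pow, cosSqrt_sq]

@[fun_prop]
theorem Function.HasTemperateGrowth.fst' {D E F : Type*} [NormedAddCommGroup D] [NormedSpace ℝ D]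
    [NormedAddCommGroup E] [NormedSpace ℝ E] [NormedAddCommGroup F] [NormedSpace ℝ F]
    {f : D → E × F} (hf : f.HasTemperateGrowth) : (fun x => (f x).1).HasTemperateGrowth :=
  (ContinuousLinearMap.fst ℝ E F).hasTemperateGrowth.comp hf

@[fun_prop]
theorem Function.HasTemperateGrowth.snd' {D E F : Type*} [NormedAddCommGroup D] [NormedSpace ℝ D]
    [NormedAddCommGroup E] [NormedSpace ℝ E] [NormedAddCommGroup F] [NormedSpace ℝ F]
    {f : D → E × F} (hf : f.HasTemperateGrowth) : (fun x => (f x).2).HasTemperateGrowth :=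
  (ContinuousLinearMap.snd ℝ E F).hasTemperateGrowth.comp hf

/-- Both cos t and sin t = cos (t − π/2) are values of `c` at squares, so they inherit its temperate
growth. -/
theorem hasTemperateGrowth_exp_mul_I :
    (fun t : ℝ => Complex.exp (t * Complex.I)).HasTemperateGrowth := by
  obtain ⟨c, hc, hcos⟩ := exists_hasTemperateGrowth_cos_eq_sq
  have h : (fun t : ℝ => Complex.exp (t * Complex.I)) =
      fun t : ℝ => c (t * t) + c ((t - Real.pi / 2) * (t - Real.pi / 2)) * Complex.I := by
    funext t
    rw [← pow_two, ← pow_two, hcos, hcos, Complex.exp_mul_I]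
    push_cast
    rw [Complex.cos_sub_pi_div_two]
  rw [h]
  have h1 : (fun t : ℝ => c (t * t)).HasTemperateGrowth :=
    hc.comp (f := fun t : ℝ => t * t) (by fun_prop)
  have h2 : (fun t : ℝ => c ((t - Real.pi / 2) * (t - Real.pi / 2))).HasTemperateGrowth :=
    hc.comp (f := fun t : ℝ => (t - Real.pi / 2) * (t - Real.pi / 2)) (by fun_prop)
  fun_prop

/-! ### Whitney's theorem on even functions and Hadamard's lemma -/

open FourierTransform in
/-- **Whitney's theorem on even functions**, with a parameter: the even part in `v` of a smooth
function of `(x, v)` is a smooth function of `(x, v ^ 2)`. -/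
theorem exists_contDiff_even_part {f : ℝ × ℝ → ℝ} (hf : ContDiff ℝ ∞ f)
    (hs : HasCompactSupport f) :
    ∃ g : ℝ × ℝ → ℝ, ContDiff ℝ ∞ g ∧
      ∀ x v : ℝ, g (x, v ^ 2) = (f (x, v) + f (x, -v)) / 2 := by
  obtain ⟨c, hc, hcos⟩ := exists_hasTemperateGrowth_cos_eq_sq
  let e : EuclideanSpace ℝ (Fin 2) ≃L[ℝ] ℝ × ℝ :=
    (EuclideanSpace.equiv (Fin 2) ℝ).trans (ContinuousLinearEquiv.finTwoArrow ℝ ℝ)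
  have he : ∀ ζ, e ζ = (ζ 0, ζ 1) := fun ζ => rfl
  have h1 : HasCompactSupport (fun ζ => (f (e ζ) : ℂ)) :=
    (hs.comp_homeomorph e.toHomeomorph).comp_left (g := fun x : ℝ => (x : ℂ)) (by simp)
  have h2 : ContDiff ℝ ∞ (fun ζ => (f (e ζ) : ℂ)) :=
    Complex.ofRealCLM.contDiff.comp (hf.comp e.contDiff)
  let S : SchwartzMap (EuclideanSpace ℝ (Fin 2)) ℂ := h1.toSchwartzMap h2
  let G : SchwartzMap (EuclideanSpace ℝ (Fin 2)) ℂ := 𝓕 S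
  have hG : ∀ k : ℕ, Integrable (fun ζ => (1 + ‖ζ‖) ^ k * ‖G ζ‖) := by
    intro k
    have : (fun ζ => (1 + ‖ζ‖) ^ k * ‖G ζ‖) =
        fun ζ => ∑ i ∈ Finset.range (k + 1), (k.choose i : ℝ) * (‖ζ‖ ^ i * ‖G ζ‖) := by
      funext ζ
      rw [add_comm, add_pow, Finset.sum_mul]
      refine Finset.sum_congr rfl fun i _ => ?_
      ring
    rw [this]
    exact integrable_finsetSum _ fun i _ => (G.integrable_pow_mul volume i).const_mul _
  have hinv : ∀ x v : ℝ, (f (x, v) : ℂ) =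
      ∫ ζ, G ζ * Complex.exp (((2 * Real.pi * (ζ 0 * x + ζ 1 * v) : ℝ) : ℂ) * Complex.I) := by
    intro x v
    have h3 : S = 𝓕⁻ G := (FourierTransform.fourierInv_fourier_eq S).symm
    have h4 : S (e.symm (x, v)) = (f (x, v) : ℂ) := by
      change (f (e (e.symm (x, v))) : ℂ) = _
      rw [e.apply_symm_apply]
    rw [← h4, h3, SchwartzMap.fourierInv_coe, Real.fourierInv_eq']
    refine integral_congr_ae (Filter.Eventually.of_forall fun ζ => ?_)
    have h5 : inner ℝ ζ (e.symm (x, v)) = ζ 0 * x + ζ 1 * v := by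
      rw [PiLp.inner_apply, Fin.sum_univ_two]
      have h6 := congrArg Prod.fst (he (e.symm (x, v)))
      have h7 := congrArg Prod.snd (he (e.symm (x, v)))
      rw [e.apply_symm_apply] at h6 h7
      simp only at h6 h7
      rw [← h6, ← h7]
      simp [mul_comm]
    simp only [h5, smul_eq_mul]
    ring
  -- The even part in v of the Fourier character is exp(2πi ζ₀x) cos(2πζ₁v), and cos(2πζ₁v) =
  -- c((2πζ₁)² v²). Replacing v² by a free variable gives a kernel defined and of temperate growth
  -- everywhere.
  let K : (ℝ × ℝ) × EuclideanSpace ℝ (Fin 2) → ℂ := fun p =>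
    Complex.exp (((2 * Real.pi * (p.2 0 * p.1.1) : ℝ) : ℂ) * Complex.I) *
      c ((2 * Real.pi * p.2 1) * (2 * Real.pi * p.2 1) * p.1.2)
  have hK : K.HasTemperateGrowth := by
    have hp : ∀ i : Fin 2,
        (fun p : (ℝ × ℝ) × EuclideanSpace ℝ (Fin 2) => p.2 i).HasTemperateGrowth := fun i =>
      (EuclideanSpace.proj i : EuclideanSpace ℝ (Fin 2) →L[ℝ] ℝ).hasTemperateGrowth.comp
        (f := fun p : (ℝ × ℝ) × EuclideanSpace ℝ (Fin 2) => p.2) (by fun_prop)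
    have h0 := hp 0
    have h1 := hp 1
    have h3 := hasTemperateGrowth_exp_mul_I.comp
      (f := fun p : (ℝ × ℝ) × EuclideanSpace ℝ (Fin 2) => 2 * Real.pi * (p.2 0 * p.1.1))
      (by fun_prop)
    have h4 := hc.comp
      (f := fun p : (ℝ × ℝ) × EuclideanSpace ℝ (Fin 2) =>
        (2 * Real.pi * p.2 1) * (2 * Real.pi * p.2 1) * p.1.2)
      (by fun_prop)
    exact h3.mul h4
  have hg := contDiff_integral_smul_of_hasTemperateGrowth (𝕜 := ℂ) (μ := volume)
    G.continuous.aestronglyMeasurable hG hK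
  refine ⟨_, Complex.reCLM.contDiff.comp hg, fun x v => ?_⟩
  have hint : ∀ v : ℝ, Integrable (fun ζ : EuclideanSpace ℝ (Fin 2) =>
      G ζ * Complex.exp (((2 * Real.pi * (ζ 0 * x + ζ 1 * v) : ℝ) : ℂ) * Complex.I)) := by
    intro v
    refine (hG 0).mono' (by fun_prop) (Filter.Eventually.of_forall fun ζ => ?_)
    rw [norm_mul, Complex.norm_exp_ofReal_mul_I]
    simp
  have key : ∫ ζ, G ζ • K ((x, v ^ 2), ζ) = ((f (x, v) : ℂ) + f (x, -v)) / 2 := by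
    rw [hinv x v, hinv x (-v), ← integral_add (hint v) (hint (-v)), ← integral_div]
    refine integral_congr_ae (Filter.Eventually.of_forall fun ζ => ?_)
    have h5 : (2 * Real.pi * ζ 1) * (2 * Real.pi * ζ 1) * v ^ 2 = (2 * Real.pi * ζ 1 * v) ^ 2 := by
      ring
    simp only [K, h5, hcos, Complex.cos, smul_eq_mul]
    have h6 : ∀ v : ℝ, ((2 * Real.pi * (ζ 0 * x + ζ 1 * v) : ℝ) : ℂ) * Complex.I =
        ((2 * Real.pi * (ζ 0 * x) : ℝ) : ℂ) * Complex.I +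
          ((2 * Real.pi * ζ 1 * v : ℝ) : ℂ) * Complex.I := by
      intro v; push_cast; ring
    rw [h6, h6, Complex.exp_add, Complex.exp_add]
    have h7 : ((2 * Real.pi * ζ 1 * (-v) : ℝ) : ℂ) = -((2 * Real.pi * ζ 1 * v : ℝ) : ℂ) := by
      push_cast; ring
    rw [h7]
    ring
  simp only [Function.comp_apply, key]
  rw [Complex.reCLM_apply, ← Complex.ofReal_add, Complex.div_ofNat_re, Complex.ofReal_re]

/-- **Hadamard's lemma** with a parameter. -/
theorem exists_contDiff_sub_eq_mul {f : ℝ × ℝ → ℝ} (hf : ContDiff ℝ ∞ f)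
    (hs : HasCompactSupport f) :
    ∃ g : ℝ × ℝ → ℝ, ContDiff ℝ ∞ g ∧ ∀ x v : ℝ, f (x, v) - f (x, 0) = v * g (x, v) := by
  -- The quotient is ∫₀¹ ∂ᵥf(x, tv) dt, the integral of this kernel.
  let K : (ℝ × ℝ) × ℝ → ℝ := fun p => fderiv ℝ f (p.1.1, p.2 * p.1.2) (0, 1)
  have h1 : (fderiv ℝ f).HasTemperateGrowth := (hs.hasTemperateGrowth hf).fderiv
  have h2 : (fun p : (ℝ × ℝ) × ℝ => (p.1.1, p.2 * p.1.2)).HasTemperateGrowth := by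
    have h3 : (fun p : (ℝ × ℝ) × ℝ => p.1.1).HasTemperateGrowth := by fun_prop
    have h4 : (fun p : (ℝ × ℝ) × ℝ => p.2 * p.1.2).HasTemperateGrowth := by fun_prop
    have h5 := ((ContinuousLinearMap.inl ℝ ℝ ℝ).hasTemperateGrowth.comp h3).add
      ((ContinuousLinearMap.inr ℝ ℝ ℝ).hasTemperateGrowth.comp h4)
    convert! h5 using 1
    funext p
    simp
  have hK : K.HasTemperateGrowth :=
    (ContinuousLinearMap.apply ℝ ℝ ((0, 1) : ℝ × ℝ)).hasTemperateGrowth.comp (h1.comp h2)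
  have hint : ∀ k : ℕ, Integrable (fun t : ℝ => (1 + ‖t‖) ^ k * ‖(1 : ℝ)‖)
      (volume.restrict (Set.Ioc (0 : ℝ) 1)) := fun k =>
    ((by fun_prop : Continuous fun t : ℝ => (1 + ‖t‖) ^ k * ‖(1 : ℝ)‖).integrableOn_Icc).mono_set
      Set.Ioc_subset_Icc_self
  refine ⟨_, contDiff_integral_smul_of_hasTemperateGrowth (φ := fun _ : ℝ => (1 : ℝ))
    aestronglyMeasurable_const hint hK, fun x v => ?_⟩
  have hderiv : ∀ t ∈ Set.uIcc (0 : ℝ) 1,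
      HasDerivAt (fun t : ℝ => f (x, t * v)) (v * K ((x, v), t)) t := by
    intro t _
    have h6 : HasDerivAt (fun t : ℝ => (x, t * v)) ((0 : ℝ), v) t := by
      simpa using (hasDerivAt_const t x).prodMk ((hasDerivAt_id t).mul_const v)
    have h7 := ((hf.differentiable (by simp)) (x, t * v)).hasFDerivAt.comp_hasDerivAt t h6
    convert! h7 using 1
    have : ((0 : ℝ), v) = v • ((0 : ℝ), (1 : ℝ)) := by simp
    rw [this, map_smul, smul_eq_mul]
  have hcont : Continuous fun t : ℝ => v * K ((x, v), t) := by
    have := hK.1.continuous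
    fun_prop
  have h8 := intervalIntegral.integral_eq_sub_of_hasDerivAt hderiv (hcont.intervalIntegrable 0 1)
  simp only [one_mul, zero_mul, intervalIntegral.integral_const_mul] at h8
  rw [← h8, intervalIntegral.integral_of_le zero_le_one]
  simp

/-! ### Cutoffs and local inverses -/

/-- A function that is smooth near a point agrees near that point with a smooth function of
compact support. -/
theorem ContDiffOn.exists_hasCompactSupport_eventuallyEq {E F : Type*} [NormedAddCommGroup E]
    [NormedSpace ℝ E] [FiniteDimensional ℝ E] [NormedAddCommGroup F] [NormedSpace ℝ F]
    {f : E → F} {U : Set E} (hU : IsOpen U) {a : E} (ha : a ∈ U) (hf : ContDiffOn ℝ ∞ f U) :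
    ∃ g : E → F, ContDiff ℝ ∞ g ∧ HasCompactSupport g ∧ g =ᶠ[𝓝 a] f := by
  obtain ⟨ρ, hρ, hsub⟩ := Metric.nhds_basis_closedBall.mem_iff.1 (hU.mem_nhds ha)
  let χ : ContDiffBump a := ⟨ρ / 2, ρ, by positivity, by linarith⟩
  refine ⟨fun x => χ x • f x, ?_, ?_, ?_⟩
  · refine contDiff_iff_contDiffAt.2 fun x => ?_
    by_cases hx : x ∈ tsupport fun x => χ x • f x
    swap
    · exact (contDiffAt_const (c := 0)).congr_of_eventuallyEq
        (notMem_tsupport_iff_eventuallyEq.1 hx)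
    have hx' : x ∈ U := hsub (χ.tsupport_eq ▸ tsupport_smul_subset_left χ f hx)
    exact χ.contDiffAt.smul (hf.contDiffAt (hU.mem_nhds hx'))
  · exact χ.hasCompactSupport.smul_right
  · filter_upwards [χ.eventuallyEq_one] with x hx
    rw [hx, Pi.one_apply, one_smul]

/-- The inverse function theorem for smooth maps. -/
theorem ContDiffOn.exists_openPartialHomeomorph {E F : Type*} [NormedAddCommGroup E]
    [NormedSpace ℝ E] [CompleteSpace E] [NormedAddCommGroup F] [NormedSpace ℝ F]
    {f : E → F} {U : Set E} (hU : IsOpen U) {a : E} (ha : a ∈ U) (hf : ContDiffOn ℝ ∞ f U)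
    {f' : E ≃L[ℝ] F} (hf' : HasFDerivAt f (f' : E →L[ℝ] F) a) :
    ∃ e : OpenPartialHomeomorph E F, a ∈ e.source ∧ e.source ⊆ U ∧ (∀ x, e x = f x) ∧
      ContDiffOn ℝ ∞ e.symm e.target := by
  have h1 : ContDiffAt ℝ ∞ f a := hf.contDiffAt (hU.mem_nhds ha)
  let e₀ := h1.toOpenPartialHomeomorph f hf' (by simp)
  have he₀ : ∀ x, e₀ x = f x := fun x => rfl
  have h2 : ContinuousOn (fderiv ℝ f) U := hf.continuousOn_fderiv_of_isOpen hU (by simp)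
  -- Restricting to the open set where the derivative is invertible makes the inverse smooth on the
  -- whole target, not only at the image of `a`.
  let V : Set E := U ∩ fderiv ℝ f ⁻¹' Set.range ((↑) : (E ≃L[ℝ] F) → E →L[ℝ] F)
  have hV : IsOpen V := h2.isOpen_inter_preimage hU ContinuousLinearEquiv.isOpen
  have haV : a ∈ V := ⟨ha, f', hf'.fderiv.symm⟩
  refine ⟨e₀.restrOpen V hV, ⟨h1.mem_toOpenPartialHomeomorph_source hf' (by simp), haV⟩,
    fun x hx => hx.2.1, he₀, fun y hy => ?_⟩
  have hx := (e₀.restrOpen V hV).map_target hy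
  obtain ⟨g', hg'⟩ := hx.2.2
  have h3 : ContDiffAt ℝ ∞ f ((e₀.restrOpen V hV).symm y) := hf.contDiffAt (hU.mem_nhds hx.2.1)
  refine ((e₀.restrOpen V hV).contDiffAt_symm (f₀' := g') hy ?_ h3).contDiffWithinAt
  have h4 : HasFDerivAt f (fderiv ℝ f ((e₀.restrOpen V hV).symm y)) _ :=
    (h3.differentiableAt (by simp)).hasFDerivAt
  rw [← hg'] at h4
  exact h4

/-! ### Composition operators on spaces of continuous functions -/

section Superposition

variable {T E : Type} [TopologicalSpace T] [CompactSpace T] [NormedAddCommGroup E] [NormedSpace ℝ E]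

/-- Pointwise evaluation of a family of continuous linear maps, as a continuous bilinear map. -/
noncomputable def ContinuousMap.clmApply (T E F : Type) [TopologicalSpace T] [CompactSpace T]
    [NormedAddCommGroup E] [NormedSpace ℝ E] [NormedAddCommGroup F] [NormedSpace ℝ F] :
    C(T, E →L[ℝ] F) →L[ℝ] C(T, E) →L[ℝ] C(T, F) :=
  LinearMap.mkContinuous₂
    (LinearMap.mk₂ ℝ (fun (A : C(T, E →L[ℝ] F)) (h : C(T, E)) => (⟨fun t => A t (h t), by fun_prop⟩ : C(T, F)))
      (fun _ _ _ => by ext; simp) (fun _ _ _ => by ext; simp)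
      (fun _ _ _ => by ext; simp) (fun _ _ _ => by ext; simp)) 1 (by
    intro A h
    rw [one_mul, ContinuousMap.norm_le _ (by positivity)]
    intro t
    exact ((A t).le_opNorm _).trans (by gcongr <;> exact ContinuousMap.norm_coe_le_norm _ t))

/-- The mean value inequality is applied at each t. Continuity of p ↦ Q' ∘ p in the sup norm
supplies one δ valid for all t. -/
theorem ContinuousMap.hasFDerivAt_comp_left {F : Type} [NormedAddCommGroup F] [NormedSpace ℝ F]
    (Q : C(E, F)) (Q' : C(E, E →L[ℝ] F)) (hQ : ∀ x, HasFDerivAt Q (Q' x) x) (p : C(T, E)) :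
    HasFDerivAt (fun p : C(T, E) => Q.comp p) (ContinuousMap.clmApply T E F (Q'.comp p)) p := by
  rw [hasFDerivAt_iff_isLittleO, Asymptotics.isLittleO_iff]
  intro ε hε
  have hcont : Continuous fun p : C(T, E) => Q'.comp p := ContinuousMap.continuous_postcomp Q'
  obtain ⟨δ, hδ, hball⟩ := Metric.eventually_nhds_iff_ball.1
    ((hcont.tendsto p).eventually (Metric.ball_mem_nhds (Q'.comp p) hε))
  filter_upwards [Metric.ball_mem_nhds p hδ] with r hr
  rw [ContinuousMap.norm_le _ (by positivity)]
  intro t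
  have ht : ∀ z ∈ Metric.ball (p t) δ, ‖Q' z - Q' (p t)‖ ≤ ε := by
    intro z hz
    -- Translating `p` by the constant z − p t gives a curve within δ of `p` with value z at t, so
    -- the sup norm estimate yields the pointwise one.
    have h1 : dist (p + ContinuousMap.const T (z - p t)) p < δ := by
      rw [dist_eq_norm, add_sub_cancel_left, ContinuousMap.norm_lt_iff _ hδ]
      intro _
      simpa [dist_eq_norm] using hz
    have h2 := (ContinuousMap.dist_apply_le_dist t).trans_lt (hball _ h1)
    rw [dist_eq_norm] at h2
    simpa using h2.le
  have hrt : r t ∈ Metric.ball (p t) δ := (ContinuousMap.dist_apply_le_dist t).trans_lt hr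
  have h3 := (convex_ball (p t) δ).norm_image_sub_le_of_norm_hasFDerivWithin_le'
    (fun z _ => (hQ z).hasFDerivWithinAt) ht (Metric.mem_ball_self hδ) hrt
  refine h3.trans ?_
  gcongr
  exact ContinuousMap.norm_coe_le_norm (r - p) t

theorem ContinuousMap.contDiff_comp_left {F : Type} [NormedAddCommGroup F] [NormedSpace ℝ F]
    (Q : C(E, F)) (hQ : ContDiff ℝ ∞ Q) : ContDiff ℝ ∞ (fun p : C(T, E) => Q.comp p) := by
  rw [contDiff_infty]
  intro n
  induction n generalizing F with
  | zero =>
    rw [Nat.cast_zero, contDiff_zero]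
    exact ContinuousMap.continuous_postcomp Q
  | succ n ih =>
    have hQ' : ContDiff ℝ ∞ (fderiv ℝ Q) := hQ.fderiv_right (by simp)
    have h := ContinuousMap.hasFDerivAt_comp_left (T := T) Q ⟨fderiv ℝ Q, hQ'.continuous⟩
      (fun x => (hQ.differentiable (by simp) x).hasFDerivAt)
    rw [Nat.cast_succ, contDiff_succ_iff_fderiv]
    refine ⟨fun p => (h p).differentiableAt, by simp, ?_⟩
    rw [funext fun p => (h p).fderiv]
    exact (ContinuousMap.clmApply T E F).contDiff.comp (ih ⟨fderiv ℝ Q, hQ'.continuous⟩ hQ')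

end Superposition

/-! ### Smooth local flow of a time-dependent scalar equation -/

section Flow

theorem neg_one_le_one_real : (-1 : ℝ) ≤ 1 := by norm_num

/-- The Volterra operator `α ↦ (t ↦ ∫₀ᵗ α)` on continuous functions on `[-1, 1]`. -/
noncomputable def volterra :
    C(Set.Icc (-1 : ℝ) 1, ℝ) →L[ℝ] C(Set.Icc (-1 : ℝ) 1, ℝ) :=
  have hc (α : C(Set.Icc (-1 : ℝ) 1, ℝ)) :
      Continuous (Set.IccExtend neg_one_le_one_real α) := α.continuous.Icc_extend'
  LinearMap.mkContinuous
    { toFun α := ⟨fun t => ∫ s in (0 : ℝ)..t, Set.IccExtend neg_one_le_one_real α s,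
        (intervalIntegral.continuous_primitive (fun a b => (hc α).intervalIntegrable a b) 0).comp
          continuous_subtype_val⟩
      map_add' α β := by
        ext t
        exact intervalIntegral.integral_add ((hc α).intervalIntegrable _ _)
          ((hc β).intervalIntegrable _ _)
      map_smul' c α := by
        ext t
        exact intervalIntegral.integral_const_mul c _ } 1 (by
    intro α
    rw [one_mul, ContinuousMap.norm_le _ (norm_nonneg _)]
    intro t
    refine (intervalIntegral.norm_integral_le_of_norm_le_const
      (fun s _ => ContinuousMap.norm_coe_le_norm α _)).trans ?_
    refine mul_le_of_le_one_right (norm_nonneg _) ?_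
    rw [sub_zero]
    exact abs_le.2 t.2)

/-- Rescaling time to [−1, 1], the curve g(t) = w(tτ, c) satisfies g(t) = c + τ ∫₀ᵗ R(g(s), τs) ds,
that is, Θ(τ, g) = (τ, c) with the constant curve c. The map Θ is smooth on ℝ × C([−1, 1]) and has
invertible derivative at 0, so g depends smoothly on (τ, c), and w(τ, c) = g(1). -/
theorem exists_local_flow {R : ℝ × ℝ → ℝ} (hR : ContDiff ℝ ∞ R) :
    ∃ ρ > 0, ∃ w : ℝ × ℝ → ℝ, ContDiffOn ℝ ∞ w (Metric.ball 0 ρ) ∧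
      (∀ p ∈ Metric.ball (0 : ℝ × ℝ) ρ,
        HasDerivAt (fun s => w (s, p.2)) (R (w p, p.1)) p.1) ∧
      ∀ c : ℝ, |c| < ρ → w (0, c) = c := by
  let T := Set.Icc (-1 : ℝ) 1
  let one : T := ⟨1, by norm_num, le_rfl⟩
  let ι : C(T, ℝ) := ⟨Subtype.val, continuous_subtype_val⟩
  let P : ℝ × C(T, ℝ) → C(T, ℝ × ℝ) := fun p =>
    (ContinuousLinearMap.inl ℝ ℝ ℝ).compLeftContinuous ℝ T p.2 +
      p.1 • (ContinuousLinearMap.inr ℝ ℝ ℝ).compLeftContinuous ℝ T ι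
  have hP : ContDiff ℝ ∞ P := by
    refine ((ContinuousLinearMap.contDiff _).comp contDiff_snd).add ?_
    exact contDiff_fst.smul contDiff_const
  let Rc : C(ℝ × ℝ, ℝ) := ⟨R, hR.continuous⟩
  let S : ℝ × C(T, ℝ) → C(T, ℝ) := fun p => volterra (Rc.comp (P p))
  have hS : ContDiff ℝ ∞ S :=
    volterra.contDiff.comp ((ContinuousMap.contDiff_comp_left Rc hR).comp hP)
  have hS_apply : ∀ (p : ℝ × C(T, ℝ)) (t : T),
      S p t = ∫ s in (0 : ℝ)..t, R (Set.IccExtend neg_one_le_one_real p.2 s, p.1 * s) := by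
    intro p t
    refine intervalIntegral.integral_congr fun s hs => ?_
    have hs' : s ∈ Set.Icc (-1 : ℝ) 1 :=
      Set.uIcc_subset_Icc (by norm_num) t.2 hs
    rw [Set.IccExtend_of_mem _ _ hs', Set.IccExtend_of_mem _ _ hs']
    simp [Rc, P, ι]
  let Θ : ℝ × C(T, ℝ) → ℝ × C(T, ℝ) := fun p => (p.1, p.2 - p.1 • S p)
  have hΘ : ContDiff ℝ ∞ Θ :=
    contDiff_fst.prodMk (contDiff_snd.sub (contDiff_fst.smul hS))
  let b : C(T, ℝ) := S 0
  let fst := ContinuousLinearMap.fst ℝ ℝ C(T, ℝ)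
  let snd := ContinuousLinearMap.snd ℝ ℝ C(T, ℝ)
  -- The derivative of Θ at 0 is (τ, h) ↦ (τ, h − τ b), inverted by changing the sign of b.
  let Θ' : (ℝ × C(T, ℝ)) ≃L[ℝ] (ℝ × C(T, ℝ)) := ContinuousLinearEquiv.equivOfInverse
    (fst.prod (snd - fst.smulRight b)) (fst.prod (snd + fst.smulRight b))
    (fun x => by ext <;> simp [fst, snd]) (fun x => by ext <;> simp [fst, snd])
  have hΘ' : HasFDerivAt Θ (Θ' : (ℝ × C(T, ℝ)) →L[ℝ] (ℝ × C(T, ℝ))) 0 := by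
    have h1 : HasFDerivAt (fun p : ℝ × C(T, ℝ) => p.1 • S p) (fst.smulRight b) 0 := by
      have h2 := (hasFDerivAt_fst (𝕜 := ℝ) (p := (0 : ℝ × C(T, ℝ)))).smul
        (hS.differentiable (by simp) 0).hasFDerivAt
      convert! h2 using 1
      simp [fst, b]
    exact hasFDerivAt_fst.prodMk (hasFDerivAt_snd.sub h1)
  obtain ⟨e, he0, -, he, hsymm⟩ := hΘ.contDiffOn.exists_openPartialHomeomorph isOpen_univ
    (Set.mem_univ 0) hΘ'
  have hΘ0 : e 0 = 0 := by rw [he]; simp [Θ]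
  obtain ⟨r, hr, hrs⟩ := Metric.mem_nhds_iff.1 (e.open_source.mem_nhds he0)
  let j : ℝ × ℝ → ℝ × C(T, ℝ) := fun p => (p.1, p.2 • (1 : C(T, ℝ)))
  have hj : ContDiff ℝ ∞ j := contDiff_fst.prodMk (contDiff_snd.smul contDiff_const)
  have hj0 : j 0 = 0 := by simp [j]
  have ht0 : (0 : ℝ × C(T, ℝ)) ∈ e.target := hΘ0 ▸ e.map_source he0
  have hsymm0 : e.symm 0 = 0 := by
    have := e.left_inv he0
    rwa [hΘ0] at this
  have hev : ∀ᶠ p in 𝓝 (0 : ℝ × ℝ), j p ∈ e.target ∧ e.symm (j p) ∈ Metric.ball 0 r := by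
    have h1 : Filter.Tendsto j (𝓝 0) (𝓝 0) := by
      simpa [hj0] using hj.continuous.tendsto 0
    have h2 : Filter.Tendsto (fun p => e.symm (j p)) (𝓝 0) (𝓝 0) := by
      have := (e.continuousAt_symm ht0).tendsto
      rw [hsymm0] at this
      exact this.comp h1
    exact (h1.eventually (e.open_target.mem_nhds ht0)).and
      (h2.eventually (Metric.ball_mem_nhds 0 hr))
  obtain ⟨ρ, hρ, hball⟩ := Metric.mem_nhds_iff.1 hev
  let g : ℝ × ℝ → C(T, ℝ) := fun p => (e.symm (j p)).2
  have hg : ∀ p ∈ Metric.ball (0 : ℝ × ℝ) ρ, e.symm (j p) = (p.1, g p) ∧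
      ∀ t : T, g p t = p.2 +
        p.1 * ∫ s in (0 : ℝ)..t, R (Set.IccExtend neg_one_le_one_real (g p) s, p.1 * s) := by
    intro p hp
    have h1 := e.right_inv (hball hp).1
    rw [he] at h1
    have h2 : (e.symm (j p)).1 = p.1 := congrArg Prod.fst h1
    have h3 : e.symm (j p) = (p.1, g p) := Prod.ext h2 rfl
    refine ⟨h3, fun t => ?_⟩
    have h4 := congrArg (fun q : ℝ × C(T, ℝ) => q.2 t) h1
    simp only [Θ, h3, j] at h4
    rw [ContinuousMap.sub_apply, ContinuousMap.smul_apply, ContinuousMap.smul_apply,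
      ContinuousMap.one_apply, hS_apply, smul_eq_mul, smul_eq_mul, mul_one] at h4
    linarith
  let w : ℝ × ℝ → ℝ := fun p => g p one
  have hw : ContDiffOn ℝ ∞ w (Metric.ball 0 ρ) := by
    have h1 : ContDiffOn ℝ ∞ (fun p => e.symm (j p)) (Metric.ball 0 ρ) :=
      hsymm.comp hj.contDiffOn fun p hp => (hball hp).1
    exact (ContinuousMap.evalCLM ℝ one).contDiff.comp_contDiffOn h1.snd
  -- The curve s ↦ g(ts) solves the problem with time parameter tτ and the same c. For |t| ≤ 1 it
  -- stays in the ball of radius r where Θ is injective, so it is the solution produced by the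
  -- inverse.
  have hscale : ∀ p ∈ Metric.ball (0 : ℝ × ℝ) ρ, ∀ t : T, w (t * p.1, p.2) = g p t := by
    intro p hp t
    have hmem : ∀ s : T, (t : ℝ) * s ∈ Set.Icc (-1 : ℝ) 1 := fun s => by
      rw [Set.mem_Icc, ← abs_le, abs_mul]
      exact mul_le_one₀ (abs_le.2 t.2) (abs_nonneg _) (abs_le.2 s.2)
    let β : C(T, ℝ) := ⟨fun s => g p ⟨t * s, hmem s⟩, by fun_prop⟩
    have hβ : Θ (t * p.1, β) = j (t * p.1, p.2) := by
      refine Prod.ext rfl (ContinuousMap.ext fun s => ?_)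
      change β s - (t * p.1) * S (t * p.1, β) s = p.2 * 1
      rw [hS_apply]
      change g p ⟨t * s, hmem s⟩ - _ = _
      rw [(hg p hp).2]
      have h1 : ∫ r in (0 : ℝ)..s, R (Set.IccExtend neg_one_le_one_real β r, t * p.1 * r) =
          ∫ r in (0 : ℝ)..s,
            R (Set.IccExtend neg_one_le_one_real (g p) (t * r), p.1 * (t * r)) := by
        refine intervalIntegral.integral_congr fun r hr => ?_
        have hr' : r ∈ Set.Icc (-1 : ℝ) 1 := Set.uIcc_subset_Icc (by norm_num) s.2 hr
        rw [Set.IccExtend_of_mem _ _ hr', Set.IccExtend_of_mem _ _ (hmem ⟨r, hr'⟩)]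
        change R (g p ⟨t * r, _⟩, _) = _
        congr 2
        ring
      have h2 := intervalIntegral.mul_integral_comp_mul_left (a := 0) (b := (s : ℝ))
        (f := fun x => R (Set.IccExtend neg_one_le_one_real (g p) x, p.1 * x)) (t : ℝ)
      rw [mul_zero] at h2
      simp only at h2 ⊢
      rw [h1, ← h2]
      ring
    have hsrc : (t * p.1, β) ∈ e.source := by
      refine hrs ?_
      have h1 := (hball hp).2
      rw [(hg p hp).1, mem_ball_zero_iff, Prod.norm_mk, max_lt_iff] at h1
      rw [mem_ball_zero_iff, Prod.norm_mk, max_lt_iff]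
      constructor
      · rw [norm_mul]
        exact (mul_le_of_le_one_left (norm_nonneg _) (abs_le.2 t.2)).trans_lt h1.1
      · rw [ContinuousMap.norm_lt_iff _ hr]
        exact fun s => (ContinuousMap.norm_coe_le_norm (g p) _).trans_lt h1.2
    have h3 := e.left_inv hsrc
    rw [he, hβ] at h3
    change (e.symm (j (t * p.1, p.2))).2 one = _
    rw [h3]
    change g p ⟨t * 1, _⟩ = g p t
    congr 1
    exact Subtype.ext (mul_one _)
  -- Undoing the time scaling turns the fixed point equation into the integral equation of the flow.
  have hint : ∀ p ∈ Metric.ball (0 : ℝ × ℝ) ρ, w p = p.2 + ∫ r in (0 : ℝ)..p.1, R (w (r, p.2), r) := by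
    intro p hp
    have h1 := (hg p hp).2 one
    have h2 : ∫ s in (0 : ℝ)..1, R (Set.IccExtend neg_one_le_one_real (g p) s, p.1 * s) =
        ∫ s in (0 : ℝ)..1, R (w (p.1 * s, p.2), p.1 * s) := by
      refine intervalIntegral.integral_congr fun s hs => ?_
      have hs' : s ∈ Set.Icc (-1 : ℝ) 1 :=
        Set.uIcc_subset_Icc (by norm_num) (by norm_num) hs
      rw [Set.IccExtend_of_mem _ _ hs', ← hscale p hp ⟨s, hs'⟩, mul_comm p.1 s]
    have h3 := intervalIntegral.mul_integral_comp_mul_left (a := 0) (b := (1 : ℝ))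
        (f := fun r => R (w (r, p.2), r)) p.1
    rw [mul_zero, mul_one] at h3
    change w p = p.2 + p.1 * ∫ s in (0 : ℝ)..1, _ at h1
    rw [h1, h2, h3]
  refine ⟨ρ, hρ, w, hw, fun p hp => ?_, fun c hc => ?_⟩
  · have hp' := hp
    rw [mem_ball_zero_iff, Prod.norm_def, max_lt_iff] at hp'
    have hmem : ∀ s ∈ Metric.ball (0 : ℝ) ρ, (s, p.2) ∈ Metric.ball (0 : ℝ × ℝ) ρ := fun s hs => by
      rw [mem_ball_zero_iff] at hs
      rw [mem_ball_zero_iff, Prod.norm_mk, max_lt_iff]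
      exact ⟨hs, hp'.2⟩
    have hp1 : p.1 ∈ Metric.ball (0 : ℝ) ρ := mem_ball_zero_iff.2 hp'.1
    have hcont : ContinuousOn (fun r : ℝ => R (w (r, p.2), r)) (Metric.ball 0 ρ) := by
      refine hR.continuous.comp_continuousOn (ContinuousOn.prodMk ?_ continuousOn_id)
      exact hw.continuousOn.comp (by fun_prop) hmem
    have h1 : HasDerivAt (fun u => ∫ r in (0 : ℝ)..u, R (w (r, p.2), r)) (R (w (p.1, p.2), p.1))
        p.1 := by
      refine intervalIntegral.integral_hasDerivAt_right ?_ ?_ ?_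
      · refine (hcont.mono ?_).intervalIntegrable
        exact (convex_ball (0 : ℝ) ρ).ordConnected.uIcc_subset (Metric.mem_ball_self hρ) hp1
      · exact hcont.stronglyMeasurableAtFilter Metric.isOpen_ball _ hp1
      · exact hcont.continuousAt (Metric.isOpen_ball.mem_nhds hp1)
    refine (h1.const_add p.2).congr_of_eventuallyEq ?_
    filter_upwards [Metric.isOpen_ball.mem_nhds hp1] with s hs
    exact hint _ (hmem s hs)
  · rw [hint (0, c) (by simpa [Prod.norm_def] using hc)]
    simp

end Flow

/-! ### Straightening a field over the fold -/

/-- The equivalence of the plane with matrix `!![a, 1; 1, 0]`. -/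
noncomputable def shearSwap (a : ℝ) : (ℝ × ℝ) ≃L[ℝ] (ℝ × ℝ) :=
  ContinuousLinearEquiv.equivOfInverse
    ((a • ContinuousLinearMap.fst ℝ ℝ ℝ + .snd ℝ ℝ ℝ).prod (.fst ℝ ℝ ℝ))
    ((ContinuousLinearMap.snd ℝ ℝ ℝ).prod (.fst ℝ ℝ ℝ - a • .snd ℝ ℝ ℝ))
    (fun x => by ext <;> simp) (fun x => by ext <;> simp)

theorem shearSwap_apply (a : ℝ) (p : ℝ × ℝ) : shearSwap a p = (a * p.1 + p.2, p.1) := rfl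

/-- The equivalence of the plane with matrix `!![1, k; 0, d]`. -/
noncomputable def upperTriangular (k : ℝ) {d : ℝ} (hd : d ≠ 0) : (ℝ × ℝ) ≃L[ℝ] (ℝ × ℝ) :=
  ContinuousLinearEquiv.equivOfInverse
    ((ContinuousLinearMap.fst ℝ ℝ ℝ + k • .snd ℝ ℝ ℝ).prod (d • .snd ℝ ℝ ℝ))
    ((ContinuousLinearMap.fst ℝ ℝ ℝ - (k / d) • .snd ℝ ℝ ℝ).prod (d⁻¹ • .snd ℝ ℝ ℝ))
    (fun x => by ext <;> simp <;> field_simp; ring) (fun x => by ext <;> simp <;> field_simp; ring)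

theorem upperTriangular_apply (k : ℝ) {d : ℝ} (hd : d ≠ 0) (p : ℝ × ℝ) :
    upperTriangular k hd p = (p.1 + k * p.2, d * p.2) := rfl

theorem ContinuousLinearMap.apply_eq_add_mul (L : ℝ × ℝ →L[ℝ] ℝ) (p : ℝ × ℝ) :
    L p = p.1 * L (1, 0) + p.2 * L (0, 1) := by
  conv_lhs => rw [show p = p.1 • ((1 : ℝ), (0 : ℝ)) + p.2 • ((0 : ℝ), (1 : ℝ)) by ext <;> simp]
  rw [map_add, map_smul, map_smul, smul_eq_mul, smul_eq_mul]

/-- A planar vector field `R ∂ₓ + ∂ᵥ` has a smooth first integral near the origin with prescribed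
values `x` on the axis `v = 0`. -/
theorem exists_first_integral {R : ℝ × ℝ → ℝ} (hR : ContDiff ℝ ∞ R) :
    ∃ (U : Set (ℝ × ℝ)) (c : ℝ × ℝ → ℝ), IsOpen U ∧ 0 ∈ U ∧ ContDiffOn ℝ ∞ c U ∧
      (∀ x : ℝ, (x, 0) ∈ U → c (x, 0) = x) ∧ ∀ p ∈ U, fderiv ℝ c p (R p, 1) = 0 := by
  obtain ⟨ρ, hρ, w, hw, hderiv, hw0⟩ := exists_local_flow hR
  have h0 : (0 : ℝ × ℝ) ∈ Metric.ball (0 : ℝ × ℝ) ρ := Metric.mem_ball_self hρ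
  have hwd : HasFDerivAt w (fderiv ℝ w 0) 0 :=
    ((hw.contDiffAt (Metric.isOpen_ball.mem_nhds h0)).differentiableAt (by simp)).hasFDerivAt
  have h1 : fderiv ℝ w 0 (1, 0) = R 0 := by
    have h2 : HasDerivAt (fun s : ℝ => (s, (0 : ℝ))) ((1 : ℝ), (0 : ℝ)) 0 :=
      (hasDerivAt_id (0 : ℝ)).prodMk (hasDerivAt_const _ _)
    have h3 := HasFDerivAt.comp_hasDerivAt (0 : ℝ) (l := w) (f := fun s => (s, (0 : ℝ))) hwd h2
    have h4 := h3.unique (hderiv 0 h0)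
    rw [h4, Prod.fst_zero, show w 0 = 0 from hw0 0 (by simpa using hρ)]
    rfl
  have h2 : fderiv ℝ w 0 (0, 1) = 1 := by
    have h2 : HasDerivAt (fun s : ℝ => ((0 : ℝ), s)) ((0 : ℝ), (1 : ℝ)) 0 :=
      (hasDerivAt_const _ _).prodMk (hasDerivAt_id (0 : ℝ))
    have h3 := HasFDerivAt.comp_hasDerivAt (0 : ℝ) (l := w) hwd h2
    refine h3.unique ((hasDerivAt_id (0 : ℝ)).congr_of_eventuallyEq ?_)
    filter_upwards [Metric.ball_mem_nhds (0 : ℝ) hρ] with s hs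
    exact hw0 s (by simpa using hs)
  -- The map (s, c) ↦ (w(s, c), s) carries ∂ₛ to the given field, so the second component of its
  -- inverse, the initial value, is a first integral.
  have hW : ContDiffOn ℝ ∞ (fun p => (w p, p.1)) (Metric.ball 0 ρ) := hw.prodMk contDiffOn_fst
  have hWd : HasFDerivAt (fun p => (w p, p.1)) (shearSwap (R 0) : ℝ × ℝ →L[ℝ] ℝ × ℝ) 0 := by
    refine (hwd.prodMk hasFDerivAt_fst).congr_fderiv (ContinuousLinearMap.ext fun p => ?_)
    change (fderiv ℝ w 0 p, p.1) = shearSwap (R 0) p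
    rw [shearSwap_apply, ContinuousLinearMap.apply_eq_add_mul, h1, h2]
    ext <;> simp [mul_comm]
  obtain ⟨e, he0, hsub, he, hsymm⟩ := hW.exists_openPartialHomeomorph Metric.isOpen_ball h0 hWd
  -- The second condition puts (0, x) in the source; its image is (x, 0), so the inverse returns
  -- c(x, 0) = x.
  have hopen : IsOpen (e.target ∩ (fun p : ℝ × ℝ => ((0 : ℝ), p.1)) ⁻¹' e.source) :=
    e.open_target.inter (e.open_source.preimage (by fun_prop))
  have hc : ContDiffOn ℝ ∞ (fun p => (e.symm p).2) e.target := hsymm.snd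
  refine ⟨_, fun p => (e.symm p).2, hopen, ⟨?_, he0⟩, hc.mono Set.inter_subset_left, ?_, ?_⟩
  · have h3 := e.map_source he0
    rwa [he, Prod.fst_zero, show w 0 = 0 from hw0 0 (by simpa using hρ)] at h3
  · rintro x ⟨-, hx⟩
    have hx' := hsub hx
    rw [mem_ball_zero_iff, Prod.norm_mk, max_lt_iff] at hx'
    have h3 := e.left_inv hx
    rw [he] at h3
    simp only [hw0 x hx'.2] at h3
    exact congrArg Prod.snd h3
  · rintro p ⟨hp, -⟩
    set q := e.symm p with hq
    have hqs : q ∈ e.source := e.map_target hp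
    have hqp : (w q, q.1) = p := by rw [← he, e.right_inv hp]
    have h3 : HasDerivAt (fun s => (w (s, q.2), s)) (R p, (1 : ℝ)) q.1 := by
      have h4 := (hderiv q (hsub hqs)).prodMk (hasDerivAt_id q.1)
      rwa [hqp] at h4
    have h4 : HasFDerivAt (fun p => (e.symm p).2) (fderiv ℝ (fun p => (e.symm p).2) p)
        (w (q.1, q.2), q.1) := by
      rw [Prod.mk.eta, hqp]
      exact ((hc.contDiffAt (e.open_target.mem_nhds hp)).differentiableAt (by simp)).hasFDerivAt
    have h5 := HasFDerivAt.comp_hasDerivAt q.1 (f := fun s => (w (s, q.2), s)) h4 h3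
    refine h5.unique ((hasDerivAt_const q.1 q.2).congr_of_eventuallyEq ?_)
    have h6 : ∀ᶠ s in 𝓝 q.1, (s, q.2) ∈ e.source :=
      (by fun_prop : Continuous fun s : ℝ => (s, q.2)).continuousAt.eventually
        (e.open_source.mem_nhds hqs)
    filter_upwards [h6] with s hs
    have h7 := e.left_inv hs
    rw [he] at h7
    change (e.symm (w (s, q.2), s)).2 = q.2
    rw [h7]

/-- The square of a function that vanishes at `0`, read in the coordinate `s = v ^ 2`, has
derivative at `0` the square of the derivative. -/
theorem HasDerivAt.eq_sq_of_comp_sq {h b : ℝ → ℝ} {h' b' : ℝ} (hh : HasDerivAt h h' 0)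
    (hb : HasDerivAt b b' 0) (hb0 : b 0 = 0) (hbh : ∀ v, h (v ^ 2) = b v ^ 2) : h' = b' ^ 2 := by
  have h0 : h 0 = 0 := by simpa [hb0] using hbh 0
  have h1 : Filter.Tendsto (fun v : ℝ => v ^ 2) (𝓝[≠] 0) (𝓝[≠] 0) := by
    refine tendsto_nhdsWithin_of_tendsto_nhds_of_eventually_within _ ?_ ?_
    · have : Filter.Tendsto (fun v : ℝ => v ^ 2) (𝓝 0) (𝓝 (0 ^ 2)) := by
        exact (continuous_pow 2).tendsto 0
      rw [zero_pow two_ne_zero] at this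
      exact this.mono_left nhdsWithin_le_nhds
    · filter_upwards [self_mem_nhdsWithin] with v hv
      exact pow_ne_zero 2 hv
  have h2 := (hasDerivAt_iff_tendsto_slope.1 hh).comp h1
  have h3 := (hasDerivAt_iff_tendsto_slope.1 hb).pow 2
  refine tendsto_nhds_unique h2 (h3.congr' ?_)
  filter_upwards [self_mem_nhdsWithin] with v hv
  simp only [Function.comp_apply, slope_def_field, h0, hb0, sub_zero, hbh]
  rw [div_pow]

/-- Straightening of a vector field `R ∂ₓ + ∂ᵥ` compatible with the fold `(x, v) ↦ (x, v ^ 2)`: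
there are local coordinates `Ψ` of the target of the fold and a lift of `Ψ` to coordinates
`((Ψ (x, v ^ 2)).1, B (x, v))` of its source in which the fold is again `(X, V) ↦ (X, V ^ 2)` and
the field is proportional to `2 ∂_X + ∂_V`. -/
theorem exists_fold_straightening {R : ℝ × ℝ → ℝ} (hR : ContDiff ℝ ∞ R) (hR0 : R 0 ≠ 0) :
    ∃ (Ψ : OpenPartialHomeomorph (ℝ × ℝ) (ℝ × ℝ)) (B : ℝ × ℝ → ℝ),
      ContDiffOn ℝ ∞ Ψ Ψ.source ∧ ContDiffOn ℝ ∞ Ψ.symm Ψ.target ∧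
      (0 : ℝ × ℝ) ∈ Ψ.source ∧ Ψ 0 = 0 ∧ B 0 = 0 ∧
      (∀ p : ℝ × ℝ, (Ψ (p.1, p.2 ^ 2)).2 = B p ^ 2) ∧
      (∀ᶠ p in 𝓝 (0 : ℝ × ℝ), (fderiv ℝ Ψ (p.1, p.2 ^ 2) (R p, 2 * p.2)).2 =
        B p * (fderiv ℝ Ψ (p.1, p.2 ^ 2) (R p, 2 * p.2)).1) ∧
      Filter.map (fun p => ((Ψ (p.1, p.2 ^ 2)).1, B p)) (𝓝 (0 : ℝ × ℝ)) = 𝓝 0 := by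
  obtain ⟨U, c₀, hU, h0U, hc₀, hc₀x, hc₀R⟩ := exists_first_integral hR
  obtain ⟨c, hc, hcs, hcc₀⟩ := hc₀.exists_hasCompactSupport_eventuallyEq hU h0U
  let σ : (ℝ × ℝ) ≃L[ℝ] (ℝ × ℝ) :=
    (ContinuousLinearEquiv.refl ℝ ℝ).prodCongr (ContinuousLinearEquiv.neg ℝ)
  have hσ : ∀ p, σ p = (p.1, -p.2) := fun p => rfl
  -- Minus half the odd part of c. The factor and the sign make c equal to its even part minus 2B,
  -- so that dX = 2 dB along the field and the slope comes out as exactly B.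
  let B : ℝ × ℝ → ℝ := fun p => (c (σ p) - c p) / 4
  have hcσ : ContDiff ℝ ∞ (fun p => c (σ p)) := hc.comp σ.contDiff
  have hB : ContDiff ℝ ∞ B := (hcσ.sub hc).div_const 4
  have hBs : HasCompactSupport (fun p => B p ^ 2) := by
    have h1 : HasCompactSupport B :=
      ((hcs.comp_homeomorph σ.toHomeomorph).sub hcs).comp_left (g := fun x : ℝ => x / 4) (by simp)
    exact h1.comp_left (g := fun x : ℝ => x ^ 2) (by simp)
  obtain ⟨X, hX, hXc⟩ := exists_contDiff_even_part hc hcs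
  obtain ⟨Y, hY, hYB⟩ := exists_contDiff_even_part (hB.pow 2) hBs
  have hBodd : ∀ x v, B (x, -v) = -B (x, v) := by
    intro x v
    simp only [B, hσ, neg_neg]
    ring
  have hY' : ∀ x v, Y (x, v ^ 2) = B (x, v) ^ 2 := by
    intro x v
    rw [hYB, hBodd]
    ring
  have hcev : ∀ᶠ p in 𝓝 (0 : ℝ × ℝ), fderiv ℝ c p (R p, 1) = 0 := by
    filter_upwards [hcc₀.eventuallyEq_nhds, hU.mem_nhds h0U] with p hp hpU
    rw [hp.fderiv_eq, hc₀R p hpU]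
  have hcx : ∀ᶠ x in 𝓝 (0 : ℝ), c (x, 0) = x := by
    have h1 : Filter.Tendsto (fun x : ℝ => (x, (0 : ℝ))) (𝓝 0) (𝓝 (0 : ℝ × ℝ)) :=
      (by fun_prop : Continuous fun x : ℝ => (x, (0 : ℝ))).tendsto 0
    filter_upwards [h1.eventually hcc₀, h1.eventually (hU.mem_nhds h0U)] with x hx hxU
    rw [hx, hc₀x x hxU]
  have hc0 : c 0 = 0 := hcx.self_of_nhds
  have hcd : ∀ p, HasFDerivAt c (fderiv ℝ c p) p := fun p =>
    (hc.differentiable (by simp) p).hasFDerivAt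
  have hBd : ∀ p, HasFDerivAt B (fderiv ℝ B p) p := fun p =>
    (hB.differentiable (by simp) p).hasFDerivAt
  have hXd : ∀ p, HasFDerivAt X (fderiv ℝ X p) p := fun p =>
    (hX.differentiable (by simp) p).hasFDerivAt
  have hYd : ∀ p, HasFDerivAt Y (fderiv ℝ Y p) p := fun p =>
    (hY.differentiable (by simp) p).hasFDerivAt
  have hinl : HasDerivAt (fun s : ℝ => (s, (0 : ℝ))) ((1 : ℝ), (0 : ℝ)) 0 :=
    (hasDerivAt_id (0 : ℝ)).prodMk (hasDerivAt_const _ _)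
  have hinr : HasDerivAt (fun s : ℝ => ((0 : ℝ), s)) ((0 : ℝ), (1 : ℝ)) 0 :=
    (hasDerivAt_const _ _).prodMk (hasDerivAt_id (0 : ℝ))
  have hc1 : fderiv ℝ c 0 (1, 0) = 1 :=
    (HasFDerivAt.comp_hasDerivAt (0 : ℝ) (f := fun s : ℝ => (s, (0 : ℝ))) (hcd 0) hinl).unique
      ((hasDerivAt_id (0 : ℝ)).congr_of_eventuallyEq hcx)
  have hc2 : fderiv ℝ c 0 (0, 1) = -R 0 := by
    have h1 := hcev.self_of_nhds
    rw [ContinuousLinearMap.apply_eq_add_mul, hc1] at h1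
    simp only at h1
    linarith
  have hBfd : ∀ p h, fderiv ℝ B p h = (fderiv ℝ c (σ p) (σ h) - fderiv ℝ c p h) / 4 := by
    intro p h
    have h1 := ((((hcd (σ p)).comp p σ.hasFDerivAt).sub (hcd p)).const_mul (1 / 4)).congr_of_eventuallyEq
      (f₁ := B) (Filter.Eventually.of_forall fun q => by simp only [B, Function.comp_apply, Pi.sub_apply]; ring)
    rw [h1.fderiv]
    change 1 / 4 * (fderiv ℝ c (σ p) (σ h) - fderiv ℝ c p h) = _
    ring
  have hσ0 : σ 0 = 0 := map_zero σ
  have hB1 : fderiv ℝ B 0 (1, 0) = 0 := by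
    rw [hBfd, hσ0, hσ]; simp
  have hB2 : fderiv ℝ B 0 (0, 1) = R 0 / 2 := by
    rw [hBfd, hσ0, hσ, ContinuousLinearMap.apply_eq_add_mul, hc1, hc2]
    simp only
    ring
  have hB0 : B 0 = 0 := by simp [B, hσ0]
  have hBx : ∀ x, B (x, 0) = 0 := by intro x; simp [B, hσ]
  have hX0 : ∀ᶠ x in 𝓝 (0 : ℝ), X (x, 0) = x := by
    filter_upwards [hcx] with x hx
    have h1 := hXc x 0
    rw [zero_pow two_ne_zero, neg_zero, hx] at h1
    rw [h1]; ring
  have hX1 : fderiv ℝ X 0 (1, 0) = 1 :=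
    (HasFDerivAt.comp_hasDerivAt (0 : ℝ) (f := fun s : ℝ => (s, (0 : ℝ))) (hXd 0) hinl).unique
      ((hasDerivAt_id (0 : ℝ)).congr_of_eventuallyEq hX0)
  have hYx : ∀ x, Y (x, 0) = 0 := by
    intro x
    have h1 := hY' x 0
    rwa [zero_pow two_ne_zero, hBx, zero_pow two_ne_zero] at h1
  have hY1 : fderiv ℝ Y 0 (1, 0) = 0 :=
    (HasFDerivAt.comp_hasDerivAt (0 : ℝ) (f := fun s : ℝ => (s, (0 : ℝ))) (hYd 0) hinl).unique
      ((hasDerivAt_const (0 : ℝ) (0 : ℝ)).congr_of_eventuallyEq (Filter.Eventually.of_forall hYx))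
  have hY2 : fderiv ℝ Y 0 (0, 1) = (R 0 / 2) ^ 2 := by
    rw [← hB2]
    exact HasDerivAt.eq_sq_of_comp_sq
      (HasFDerivAt.comp_hasDerivAt (0 : ℝ) (f := fun s : ℝ => ((0 : ℝ), s)) (hYd 0) hinr)
      (HasFDerivAt.comp_hasDerivAt (0 : ℝ) (f := fun s : ℝ => ((0 : ℝ), s)) (hBd 0) hinr)
      hB0 (fun v => hY' 0 v)
  -- Transversality of the field to X-constant directions, R(0) ≠ 0, makes (X, Y) a local
  -- diffeomorphism.
  have hd : (R 0 / 2) ^ 2 ≠ 0 := pow_ne_zero 2 (div_ne_zero hR0 two_ne_zero)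
  have hΨ : ContDiff ℝ ∞ (fun p => (X p, Y p)) := hX.prodMk hY
  have hΨd : HasFDerivAt (fun p => (X p, Y p))
      (upperTriangular (fderiv ℝ X 0 (0, 1)) hd : ℝ × ℝ →L[ℝ] ℝ × ℝ) 0 := by
    refine ((hXd 0).prodMk (hYd 0)).congr_fderiv (ContinuousLinearMap.ext fun p => ?_)
    change (fderiv ℝ X 0 p, fderiv ℝ Y 0 p) = upperTriangular _ hd p
    rw [upperTriangular_apply, ContinuousLinearMap.apply_eq_add_mul (fderiv ℝ X 0),
      ContinuousLinearMap.apply_eq_add_mul (fderiv ℝ Y 0), hX1, hY1, hY2]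
    ext <;> simp [mul_comm]
  obtain ⟨Ψ, h0Ψ, -, hΨeq, hΨsymm⟩ :=
    hΨ.contDiffOn.exists_openPartialHomeomorph isOpen_univ (Set.mem_univ 0) hΨd
  have hΨfun : (Ψ : ℝ × ℝ → ℝ × ℝ) = fun p => (X p, Y p) := funext hΨeq
  refine ⟨Ψ, B, ?_, hΨsymm, h0Ψ, ?_, hB0, ?_, ?_, ?_⟩
  · rw [hΨfun]; exact hΨ.contDiffOn
  · rw [hΨeq]
    exact Prod.ext hX0.self_of_nhds (hYx 0)
  · intro p
    rw [hΨeq]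
    exact hY' p.1 p.2
  · filter_upwards [hcev] with p hp
    have hsq : HasFDerivAt (fun q : ℝ × ℝ => (q.1, q.2 ^ 2))
        ((ContinuousLinearMap.fst ℝ ℝ ℝ).prod ((2 * p.2) • .snd ℝ ℝ ℝ)) p := by
      refine hasFDerivAt_fst.prodMk ?_
      have h1 := (hasFDerivAt_snd (𝕜 := ℝ) (p := p)).pow 2
      convert! h1 using 1
      ext <;> simp
    have hXB : fderiv ℝ X (p.1, p.2 ^ 2) (R p, 2 * p.2) = 2 * fderiv ℝ B p (R p, 1) := by
      have h1 := HasFDerivAt.comp p (f := fun q : ℝ × ℝ => (q.1, q.2 ^ 2)) (hXd (p.1, p.2 ^ 2)) hsq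
      have h2 : HasFDerivAt (X ∘ fun q : ℝ × ℝ => (q.1, q.2 ^ 2))
          (fderiv ℝ c p + (2 : ℝ) • fderiv ℝ B p) p := by
        refine ((hcd p).add ((hBd p).const_mul 2)).congr_of_eventuallyEq
          (Filter.Eventually.of_forall fun q => ?_)
        simp only [Function.comp_apply, hXc, B, hσ, Pi.add_apply]
        ring
      have h3 := DFunLike.congr_fun (h1.unique h2) (R p, 1)
      simpa [hp] using h3
    have hYB' : fderiv ℝ Y (p.1, p.2 ^ 2) (R p, 2 * p.2) =
        2 * B p * fderiv ℝ B p (R p, 1) := by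
      have h1 := HasFDerivAt.comp p (f := fun q : ℝ × ℝ => (q.1, q.2 ^ 2)) (hYd (p.1, p.2 ^ 2)) hsq
      have h2 : HasFDerivAt (Y ∘ fun q : ℝ × ℝ => (q.1, q.2 ^ 2))
          ((2 * B p) • fderiv ℝ B p) p := by
        have h4 := (hBd p).pow 2
        refine (h4.congr_fderiv (by ext <;> simp)).congr_of_eventuallyEq
          (Filter.Eventually.of_forall fun q => ?_)
        exact hY' q.1 q.2
      have h3 := DFunLike.congr_fun (h1.unique h2) (R p, 1)
      simpa using h3
    rw [hΨfun, ((hXd _).prodMk (hYd _)).fderiv]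
    simp only [ContinuousLinearMap.prod_apply]
    rw [hXB, hYB']
    ring
  · have hdB : R 0 / 2 ≠ 0 := div_ne_zero hR0 two_ne_zero
    let A : ℝ × ℝ → ℝ := fun p => X (p.1, p.2 ^ 2)
    have hA : ContDiff ℝ ∞ A := hX.comp (contDiff_fst.prodMk (contDiff_snd.pow 2))
    have hAd : HasFDerivAt A (fderiv ℝ c 0 + (2 : ℝ) • fderiv ℝ B 0) 0 := by
      refine ((hcd 0).add ((hBd 0).const_mul 2)).congr_of_eventuallyEq
        (Filter.Eventually.of_forall fun q => ?_)
      simp only [A, hXc, B, hσ, Pi.add_apply]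
      ring
    have hθ : HasFDerivAt (fun p => (A p, B p))
        (upperTriangular 0 hdB : ℝ × ℝ →L[ℝ] ℝ × ℝ) 0 := by
      refine (hAd.prodMk (hBd 0)).congr_fderiv (ContinuousLinearMap.ext fun p => ?_)
      change (fderiv ℝ c 0 p + 2 * fderiv ℝ B 0 p, fderiv ℝ B 0 p) = upperTriangular 0 hdB p
      rw [upperTriangular_apply, ContinuousLinearMap.apply_eq_add_mul (fderiv ℝ c 0),
        ContinuousLinearMap.apply_eq_add_mul (fderiv ℝ B 0), hc1, hc2, hB1, hB2]
      ext
      · simp only; ring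
      · simp only; ring
    -- The lift (A, B) has derivative diag(1, R(0)/2) at 0, hence maps neighbourhoods of 0 onto
    -- neighbourhoods of 0.
    have hstrict := ((hA.prodMk hB).contDiffAt.hasStrictFDerivAt' hθ (by simp))
    have h1 := hstrict.map_nhds_eq_of_equiv
    have hA0 : A 0 = 0 := by
      have h2 : X (0, 0) = 0 := hX0.self_of_nhds
      simpa [A] using h2
    rw [hA0, hB0] at h1
    simp only [hΨeq]
    exact h1

/-! ### Contact elements in homogeneous coordinates -/

theorem exists_eq_smul_of_mul_eq_mul {a b : Plane} (ha : a ≠ 0) (h : a.1 * b.2 - a.2 * b.1 = 0) :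
    ∃ c : ℝ, b = c • a := by
  have hne : a.1 ^ 2 + a.2 ^ 2 ≠ 0 := by
    intro h0
    apply ha
    have h1 : a.1 = 0 := by nlinarith [sq_nonneg a.1, sq_nonneg a.2]
    have h2 : a.2 = 0 := by nlinarith [sq_nonneg a.1, sq_nonneg a.2]
    exact Prod.ext h1 h2
  -- The coefficient of the orthogonal projection of b onto a.
  refine ⟨(a.1 * b.1 + a.2 * b.2) / (a.1 ^ 2 + a.2 ^ 2), Prod.ext ?_ ?_⟩
  · rw [Prod.smul_fst, smul_eq_mul, div_mul_eq_mul_div, eq_div_iff hne]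
    linear_combination (-a.2) * h
  · rw [Prod.smul_snd, smul_eq_mul, div_mul_eq_mul_div, eq_div_iff hne]
    linear_combination a.1 * h

section Represents

theorem Represents.ne_zero {w : Plane × Plane} {m : ContactElement} (h : Represents w m) :
    w.2 ≠ 0 := h.2.1

theorem represents_mk (z : Plane) {v : Plane} (hv : v ≠ 0) :
    Represents (z, v) (z, Projectivization.mk ℝ v hv) := ⟨rfl, hv, rfl⟩

theorem Represents.eq_of_smul {w : Plane × Plane} {m m' : ContactElement} {c : ℝ}
    (h : Represents w m) (h' : Represents (w.1, c • w.2) m') : m = m' := by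
  obtain ⟨h1, h2, h3⟩ := h
  obtain ⟨h1', h2', h3'⟩ := h'
  refine Prod.ext (h1.trans h1'.symm) ?_
  rw [h3, h3', Projectivization.mk_eq_mk_iff']
  have hc : c ≠ 0 := by rintro rfl; simp at h2'
  exact ⟨c⁻¹, by simp [smul_smul, inv_mul_cancel₀ hc]⟩

theorem Represents.unique {w : Plane × Plane} {m m' : ContactElement}
    (h : Represents w m) (h' : Represents w m') : m = m' :=
  h.eq_of_smul (c := 1) (by simpa using h')

theorem Represents.exists_smul {w w' : Plane × Plane} {m : ContactElement}
    (h : Represents w m) (h' : Represents w' m) : ∃ c : ℝ, c ≠ 0 ∧ w' = (w.1, c • w.2) := by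
  obtain ⟨h1, h2, h3⟩ := h
  obtain ⟨h1', h2', h3'⟩ := h'
  rw [h3, eq_comm, Projectivization.mk_eq_mk_iff'] at h3'
  obtain ⟨c, hc⟩ := h3'
  refine ⟨c, ?_, Prod.ext (h1'.symm.trans h1) hc.symm⟩
  rintro rfl
  exact h2' (by rw [← hc, zero_smul])

theorem isOpen_setOf_represents_mem {O : Set ContactElement} (hO : IsOpen O) :
    IsOpen {w : Plane × Plane | ∃ m ∈ O, Represents w m} := by
  let f : {w : Plane × Plane // w.2 ≠ 0} → ContactElement :=
    fun w => (w.1.1, Projectivization.mk ℝ w.1.2 w.2)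
  have hf : Continuous f := by
    refine (continuous_fst.comp continuous_subtype_val).prodMk ?_
    have h1 : Continuous fun v : {v : Plane // v ≠ 0} => Projectivization.mk ℝ v.1 v.2 :=
      continuous_quotient_mk'
    exact h1.comp (f := fun w : {w : Plane × Plane // w.2 ≠ 0} => ⟨w.1.2, w.2⟩)
      ((continuous_snd.comp continuous_subtype_val).subtype_mk _)
  have hopen : IsOpen {w : Plane × Plane | w.2 ≠ 0} := isOpen_ne_fun continuous_snd continuous_const
  have h2 := hopen.isOpenMap_subtype_val _ (hO.preimage hf)
  convert h2 using 1
  ext w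
  constructor
  · rintro ⟨m, hm, h⟩
    refine ⟨⟨w, h.ne_zero⟩, ?_, rfl⟩
    have h3 : f ⟨w, h.ne_zero⟩ = m := (represents_mk w.1 h.ne_zero).unique h
    rwa [Set.mem_preimage, h3]
  · rintro ⟨w, hw, rfl⟩
    exact ⟨_, hw, represents_mk _ w.2⟩

theorem eventually_mem_of_represents {X : Type*} [TopologicalSpace X] {H : X → Plane × Plane}
    {x : X} (hH : ContinuousAt H x) {m : ContactElement} (hm : Represents (H x) m)
    {O : Set ContactElement} (hO : IsOpen O) (hmO : m ∈ O) :
    ∀ᶠ y in 𝓝 x, ∀ m', Represents (H y) m' → m' ∈ O := by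
  filter_upwards [hH.eventually ((isOpen_setOf_represents_mem hO).mem_nhds ⟨m, hmO, hm⟩)]
    with y hy m' hm'
  obtain ⟨m'', h1, h2⟩ := hy
  rwa [hm'.unique h2]

/-- The slope is an affine chart of the projective line around [1 : 0]; this transfers properties of
(x, y, p) near 0 to nearby contact elements. -/
theorem eventually_originElement_exists_represents {S : Set (Plane × ℝ)} (hS : S ∈ 𝓝 0) :
    ∀ᶠ q in 𝓝 originElement, ∃ z : Plane × ℝ, z ∈ S ∧ Represents (z.1, (1, z.2)) q := by
  rw [show (0 : Plane × ℝ) = (0, 0) from rfl, nhds_prod_eq, Filter.mem_prod_iff] at hS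
  obtain ⟨A, hA, I, hI, hsub⟩ := hS
  have hA' : ∀ᶠ q in 𝓝 originElement, q.1 ∈ A := continuous_fst.continuousAt.eventually hA
  obtain ⟨J, hJI, hJ, h0J⟩ := mem_nhds_iff.1 hI
  let O : Set (ℙ ℝ Plane) := {l | ∃ s ∈ J, l = Projectivization.mk ℝ ((1, s) : Plane) (by simp)}
  have hO : IsOpen O := by
    have h1 : IsOpen {v : {v : Plane // v ≠ 0} | v.1.1 ≠ 0 ∧ v.1.2 / v.1.1 ∈ J} := by
      have h2 : IsOpen {v : {v : Plane // v ≠ 0} | v.1.1 ≠ 0} :=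
        isOpen_ne_fun (by fun_prop) continuous_const
      have h3 : ContinuousOn (fun v : {v : Plane // v ≠ 0} => v.1.2 / v.1.1)
          {v : {v : Plane // v ≠ 0} | v.1.1 ≠ 0} :=
        ContinuousOn.div (by fun_prop) (by fun_prop) fun v hv => hv
      exact h3.isOpen_inter_preimage h2 hJ
    refine isOpen_coinduced.2 ?_
    convert h1 using 1
    ext v
    constructor
    · rintro ⟨s, hs, h⟩
      obtain ⟨c, hc⟩ := (Projectivization.mk_eq_mk_iff' ℝ v.1 (1, s) v.2 (by simp)).1 h
      have hc0 : c ≠ 0 := by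
        rintro rfl
        exact v.2 (by rw [← hc, zero_smul])
      have h4 : v.1.1 = c := by rw [← hc]; simp
      have h5 : v.1.2 = c * s := by rw [← hc]; simp
      refine ⟨by rwa [h4], ?_⟩
      rwa [h4, h5, mul_div_cancel_left₀ _ hc0]
    · rintro ⟨h4, h5⟩
      refine ⟨_, h5, (Projectivization.mk_eq_mk_iff' ℝ v.1 _ v.2 (by simp)).2 ⟨v.1.1, ?_⟩⟩
      ext
      · simp
      · simp [mul_div_cancel₀ _ h4]
  have hO' : ∀ᶠ q in 𝓝 originElement, q.2 ∈ O :=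
    continuous_snd.continuousAt.eventually (hO.mem_nhds ⟨0, h0J, rfl⟩)
  filter_upwards [hA', hO'] with q hq1 hq2
  obtain ⟨s, hs, h⟩ := hq2
  exact ⟨(q.1, s), hsub ⟨hq1, hJI hs⟩, rfl, by simp, h⟩

theorem mem_quadraticLegendrianODE_surface_iff {q : ContactElement} :
    q ∈ quadraticLegendrianODE.surface ↔ ∃ x v : ℝ, Represents ((x, v ^ 2), (1, v)) q := by
  constructor
  · rintro ⟨w, ⟨hw, -⟩, hq, hF⟩
    change (w.2.2 / w.2.1) ^ 2 - w.1.2 = 0 at hF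
    refine ⟨w.1.1, w.2.2 / w.2.1, ?_⟩
    have h1 : w = (w.1, w.2.1 • ((1 : ℝ), w.2.2 / w.2.1)) := by
      ext
      · rfl
      · rfl
      · simp
      · simp [mul_div_cancel₀ _ hw]
    have h2 : w.1 = (w.1.1, (w.2.2 / w.2.1) ^ 2) := Prod.ext rfl (by simp only; linarith)
    rw [← h2]
    have h3 := represents_mk w.1 (v := (1, w.2.2 / w.2.1)) (by simp)
    rw [h1] at hq
    exact h3.eq_of_smul hq ▸ h3
  · rintro ⟨x, v, h⟩
    refine ⟨_, ⟨one_ne_zero, Set.mem_univ _⟩, h, ?_⟩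
    change (v / 1) ^ 2 - v ^ 2 = 0
    simp

end Represents

/-! ### Prolongation of diffeomorphisms -/

section Diffeo

variable {φ : OpenPartialHomeomorph Plane Plane}

theorem IsSmoothDiffeo.symm (hφ : IsSmoothDiffeo φ) : IsSmoothDiffeo φ.symm :=
  ⟨hφ.2, hφ.1⟩

theorem IsSmoothDiffeo.trans {ψ : OpenPartialHomeomorph Plane Plane} (hφ : IsSmoothDiffeo φ)
    (hψ : IsSmoothDiffeo ψ) : IsSmoothDiffeo (φ.trans ψ) := by
  have key : ∀ {φ ψ : OpenPartialHomeomorph Plane Plane}, ContDiffOn ℝ ∞ φ φ.source →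
      ContDiffOn ℝ ∞ ψ ψ.source → ContDiffOn ℝ ∞ (φ.trans ψ) (φ.trans ψ).source := by
    intro φ ψ hφ hψ
    rw [OpenPartialHomeomorph.coe_trans, OpenPartialHomeomorph.trans_source]
    exact hψ.comp (hφ.mono Set.inter_subset_left) fun x hx => hx.2
  refine ⟨key hφ.1 hψ.1, ?_⟩
  have h1 := key hψ.symm.1 hφ.symm.1
  rwa [← OpenPartialHomeomorph.trans_symm_eq_symm_trans_symm] at h1

theorem IsSmoothDiffeo.hasFDerivAt (hφ : IsSmoothDiffeo φ) {z : Plane} (hz : z ∈ φ.source) :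
    HasFDerivAt φ (fderiv ℝ φ z) z :=
  ((hφ.1.contDiffAt (φ.open_source.mem_nhds hz)).differentiableAt (by simp)).hasFDerivAt

theorem IsSmoothDiffeo.fderiv_symm_apply (hφ : IsSmoothDiffeo φ) {z : Plane} (hz : z ∈ φ.source)
    (v : Plane) : fderiv ℝ φ.symm (φ z) (fderiv ℝ φ z v) = v := by
  have h1 := (hφ.symm.hasFDerivAt (φ.map_source hz)).comp z (hφ.hasFDerivAt hz)
  have h2 : HasFDerivAt (φ.symm ∘ φ) (ContinuousLinearMap.id ℝ Plane) z := by
    refine (hasFDerivAt_id z).congr_of_eventuallyEq ?_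
    filter_upwards [φ.open_source.mem_nhds hz] with y hy
    exact φ.left_inv hy
  exact DFunLike.congr_fun (h1.unique h2) v

theorem IsSmoothDiffeo.fderiv_injective (hφ : IsSmoothDiffeo φ) {z : Plane} (hz : z ∈ φ.source) :
    Function.Injective (fderiv ℝ φ z) :=
  Function.LeftInverse.injective (hφ.fderiv_symm_apply hz)

theorem IsSmoothDiffeo.represents_prolong (hφ : IsSmoothDiffeo φ) {w : Plane × Plane}
    {q : ContactElement} (hw : Represents w q) (hz : w.1 ∈ φ.source) :
    Represents (φ w.1, fderiv ℝ φ w.1 w.2) (prolong φ q) := by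
  obtain ⟨h1, h2, h3⟩ := hw
  have hinj : Function.Injective (fderiv ℝ φ q.1 : Plane →ₗ[ℝ] Plane) := by
    rw [h1]
    exact hφ.fderiv_injective hz
  rw [← h1] at hz ⊢
  have hne : fderiv ℝ φ q.1 w.2 ≠ 0 := fun h0 =>
    h2 (hφ.fderiv_injective hz (h0.trans (map_zero _).symm))
  refine ⟨rfl, hne, ?_⟩
  rw [prolong, dif_pos hinj, h3, Projectivization.map_mk]
  rfl

theorem IsSmoothDiffeo.prolong_injOn (hφ : IsSmoothDiffeo φ) {q q' : ContactElement}
    (hq : q.1 ∈ φ.source) (hq' : q'.1 ∈ φ.source) (h : prolong φ q = prolong φ q') : q = q' := by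
  have hrep : ∀ q : ContactElement, ∃ w, Represents w q := fun q =>
    ⟨(q.1, q.2.rep), rfl, q.2.rep_nonzero, q.2.mk_rep.symm⟩
  have key : ∀ q : ContactElement, q.1 ∈ φ.source → prolong φ.symm (prolong φ q) = q := by
    intro q hq
    obtain ⟨w, hw⟩ := hrep q
    have hw1 : w.1 ∈ φ.source := hw.1 ▸ hq
    have h1 := hφ.represents_prolong hw hw1
    have h2 := hφ.symm.represents_prolong h1 (φ.map_source hw1)
    simp only [φ.left_inv hw1, hφ.fderiv_symm_apply hw1] at h2
    exact h2.unique hw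
  rw [← key q hq, ← key q' hq', h]

end Diffeo

/-! ### The direction field on a folded surface -/

namespace ImplicitODE

variable {E : ImplicitODE}

/-- By homogeneity, vanishing of F does not depend on the chosen homogeneous coordinates. -/
theorem mem_dom_of_represents {m : ContactElement} (hm : m ∈ E.surface) {w : Plane × Plane}
    (hw : Represents w m) : w ∈ E.dom ∧ E.F w = 0 := by
  obtain ⟨w', hw', h, hF⟩ := hm
  obtain ⟨c, hc, rfl⟩ := h.exists_smul hw
  exact ⟨E.smul_mem w' hw' c hc, by rw [E.homogeneous w' hw' c hc, hF, mul_zero]⟩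

theorem hasFDerivAt {w : Plane × Plane} (hw : w ∈ E.dom) : HasFDerivAt E.F (fderiv ℝ E.F w) w :=
  ((E.smooth.contDiffAt (E.isOpen_dom.mem_nhds hw)).differentiableAt (by simp)).hasFDerivAt

/-- Euler's relation at a zero: F vanishes along the line spanned by the direction. -/
theorem fderiv_vertical_self {w : Plane × Plane} (hw : w ∈ E.dom) (hF : E.F w = 0) :
    fderiv ℝ E.F w (0, w.2) = 0 := by
  have h1 : HasDerivAt (fun s : ℝ => (w.1, s • w.2)) ((0 : Plane), w.2) 1 := by
    simpa using (hasDerivAt_const (1 : ℝ) w.1).prodMk ((hasDerivAt_id (1 : ℝ)).smul_const w.2)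
  have h2 : HasFDerivAt E.F (fderiv ℝ E.F w) (w.1, (1 : ℝ) • w.2) := by
    rw [one_smul]
    exact E.hasFDerivAt hw
  have h3 := HasFDerivAt.comp_hasDerivAt (1 : ℝ) (f := fun s : ℝ => (w.1, s • w.2)) h2 h1
  refine h3.unique ((hasDerivAt_const (1 : ℝ) (0 : ℝ)).congr_of_eventuallyEq ?_)
  filter_upwards [isOpen_ne.mem_nhds (one_ne_zero : (1 : ℝ) ≠ 0)] with s hs
  change E.F (w.1, s • w.2) = 0
  rw [E.homogeneous w hw s hs, hF, mul_zero]

end ImplicitODE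

/-- Homogeneous coordinates `w` of a parametrization `(u, v) ↦ γ (u, v)` of the surface of `E` near
a point of the surface, in which the projection to the plane becomes `(u, v) ↦ (u, v ^ 2)` in the
chart `k` of the plane. -/
structure FoldLift (E : ImplicitODE) (N : Set (ℝ × ℝ)) (w : ℝ × ℝ → Plane × Plane)
    (k : OpenPartialHomeomorph Plane Plane) : Prop where
  isOpen : IsOpen N
  zero_mem : 0 ∈ N
  smooth : ContDiffOn ℝ ∞ w N
  immersion : ∀ t ∈ N, ∀ τ : ℝ × ℝ, (∃ c : ℝ, fderiv ℝ w t τ = (0, c • (w t).2)) → τ = 0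
  mem_dom : ∀ t ∈ N, w t ∈ E.dom
  eq_zero : ∀ t ∈ N, E.F (w t) = 0
  diffeo : IsSmoothDiffeo k
  mem_source : ∀ t ∈ N, (w t).1 ∈ k.source
  fold : ∀ t ∈ N, k (w t).1 = (t.1, t.2 ^ 2)

namespace FoldLift

variable {E : ImplicitODE} {N : Set (ℝ × ℝ)} {w : ℝ × ℝ → Plane × Plane}
  {k : OpenPartialHomeomorph Plane Plane}

theorem hasFDerivAt (h : FoldLift E N w k) {t : ℝ × ℝ} (ht : t ∈ N) :
    HasFDerivAt w (fderiv ℝ w t) t :=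
  ((h.smooth.contDiffAt (h.isOpen.mem_nhds ht)).differentiableAt (by simp)).hasFDerivAt

theorem direction_ne_zero (h : FoldLift E N w k) {t : ℝ × ℝ} (ht : t ∈ N) : (w t).2 ≠ 0 :=
  E.ne_zero_of_mem _ (h.mem_dom t ht)

theorem fderiv_chart_apply (h : FoldLift E N w k) {t : ℝ × ℝ} (ht : t ∈ N) (τ : ℝ × ℝ) :
    fderiv ℝ k (w t).1 (fderiv ℝ w t τ).1 = (τ.1, 2 * t.2 * τ.2) := by
  have h1 : HasFDerivAt (fun t => k (w t).1)
      ((fderiv ℝ k (w t).1).comp ((ContinuousLinearMap.fst ℝ Plane Plane).comp (fderiv ℝ w t))) t :=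
    HasFDerivAt.comp t (f := fun t => (w t).1) (h.diffeo.hasFDerivAt (h.mem_source t ht))
      ((h.hasFDerivAt ht).fst)
  have h2 : HasFDerivAt (fun q : ℝ × ℝ => (q.1, q.2 ^ 2))
      ((ContinuousLinearMap.fst ℝ ℝ ℝ).prod ((2 * t.2) • .snd ℝ ℝ ℝ)) t := by
    refine hasFDerivAt_fst.prodMk ?_
    have h1 := (hasFDerivAt_snd (𝕜 := ℝ) (p := t)).pow 2
    convert! h1 using 1
    ext <;> simp
  have h3 := h2.congr_of_eventuallyEq (f₁ := fun t => k (w t).1)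
    (by filter_upwards [h.isOpen.mem_nhds ht] with s hs using h.fold s hs)
  exact DFunLike.congr_fun (h1.unique h3) τ

theorem fderiv_fst_eq_zero (h : FoldLift E N w k) {u : ℝ} (hu : (u, 0) ∈ N) :
    (fderiv ℝ w (u, 0) (0, 1)).1 = 0 := by
  refine h.diffeo.fderiv_injective (h.mem_source _ hu) ?_
  rw [h.fderiv_chart_apply hu, map_zero]
  simp

/-- On the fold line ∂ᵥ is killed by the projection, so an immersion must turn the direction along
it. -/
theorem not_exists_smul (h : FoldLift E N w k) {u : ℝ} (hu : (u, 0) ∈ N) :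
    ¬ ∃ c : ℝ, (fderiv ℝ w (u, 0) (0, 1)).2 = c • (w (u, 0)).2 := by
  rintro ⟨c, hc⟩
  have h1 := h.immersion _ hu (0, 1) ⟨c, Prod.ext (h.fderiv_fst_eq_zero hu) hc⟩
  simp at h1

/-- The vertical derivative of F kills the direction a by Euler's relation, and b = ∂ᵥ of the
direction because (0, b) is tangent to the surface. These two vectors span the plane. -/
theorem mem_criminant (h : FoldLift E N w k) {u : ℝ} (hu : (u, 0) ∈ N) {m : ContactElement}
    (hm : Represents (w (u, 0)) m) : m ∈ E.criminant := by
  refine ⟨_, h.mem_dom _ hu, hm, h.eq_zero _ hu, fun v => ?_⟩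
  set a := (w (u, 0)).2 with ha
  set b := (fderiv ℝ w (u, 0) (0, 1)).2 with hb
  have ha0 : a ≠ 0 := h.direction_ne_zero hu
  have hdet : a.1 * b.2 - a.2 * b.1 ≠ 0 := fun h0 =>
    h.not_exists_smul hu (exists_eq_smul_of_mul_eq_mul ha0 h0)
  have h1 : fderiv ℝ E.F (w (u, 0)) (0, a) = 0 :=
    E.fderiv_vertical_self (h.mem_dom _ hu) (h.eq_zero _ hu)
  have h2 : fderiv ℝ E.F (w (u, 0)) (0, b) = 0 := by
    have h3 := (E.hasFDerivAt (h.mem_dom _ hu)).comp (u, (0 : ℝ)) (h.hasFDerivAt hu)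
    have h4 : HasFDerivAt (E.F ∘ w) (0 : ℝ × ℝ →L[ℝ] ℝ) (u, 0) :=
      (hasFDerivAt_const (0 : ℝ) _).congr_of_eventuallyEq
        (by filter_upwards [h.isOpen.mem_nhds hu] with s hs using h.eq_zero s hs)
    have h5 := DFunLike.congr_fun (h3.unique h4) (0, 1)
    have h6 : fderiv ℝ w (u, 0) (0, 1) = (0, b) := Prod.ext (h.fderiv_fst_eq_zero hu) rfl
    rw [ContinuousLinearMap.comp_apply, h6] at h5
    exact h5
  -- Cramer's rule in the basis a, b.
  have h3 : ((0 : Plane), v) =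
      ((v.1 * b.2 - v.2 * b.1) / (a.1 * b.2 - a.2 * b.1)) • ((0 : Plane), a) +
        ((a.1 * v.2 - a.2 * v.1) / (a.1 * b.2 - a.2 * b.1)) • ((0 : Plane), b) := by
    ext
    · simp
    · simp
    · change v.1 = _ / _ * a.1 + _ / _ * b.1
      rw [div_mul_eq_mul_div, div_mul_eq_mul_div, ← add_div, eq_div_iff hdet]
      ring
    · change v.2 = _ / _ * a.2 + _ / _ * b.2
      rw [div_mul_eq_mul_div, div_mul_eq_mul_div, ← add_div, eq_div_iff hdet]
      ring
  rw [h3, map_add, map_smul, map_smul, h1, h2, smul_zero, smul_zero, add_zero]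

/-- The direction field of the equation on its surface, in the coordinates of the chart `k`. -/
noncomputable def direction (w : ℝ × ℝ → Plane × Plane) (k : OpenPartialHomeomorph Plane Plane)
    (t : ℝ × ℝ) : Plane :=
  fderiv ℝ k (w t).1 (w t).2

theorem direction_smooth (h : FoldLift E N w k) : ContDiffOn ℝ ∞ (direction w k) N := by
  have h1 : ContDiffOn ℝ ∞ (fderiv ℝ k) k.source :=
    h.diffeo.1.fderiv_of_isOpen k.open_source (by simp)
  exact (h1.comp h.smooth.fst h.mem_source).clm_apply h.smooth.snd

theorem chart_direction_ne_zero (h : FoldLift E N w k) {t : ℝ × ℝ} (ht : t ∈ N) :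
    direction w k t ≠ 0 := fun h0 =>
  h.direction_ne_zero ht
    (h.diffeo.fderiv_injective (h.mem_source t ht) (h0.trans (map_zero _).symm))

/-- The fold line lies in the criminant, so the velocity of its projection is a multiple of the
direction. In the chart `k` that velocity is (1, 0). -/
theorem direction_snd_eq_zero (h : FoldLift E N w k) (hL : IsLegendrian E.criminant) {u : ℝ}
    (hu : (u, 0) ∈ N) : (direction w k (u, 0)).2 = 0 := by
  let W : ℝ → Plane × Plane := fun s => w (u + s, 0)
  have hline : HasDerivAt (fun s : ℝ => (u + s, (0 : ℝ))) ((1 : ℝ), (0 : ℝ)) 0 :=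
    ((hasDerivAt_id (0 : ℝ)).const_add u).prodMk (hasDerivAt_const _ _)
  have hu' : (u + 0, (0 : ℝ)) ∈ N := by rwa [add_zero]
  have hmem : ∀ᶠ s in 𝓝 (0 : ℝ), (u + s, (0 : ℝ)) ∈ N :=
    (by fun_prop : Continuous fun s : ℝ => (u + s, (0 : ℝ))).continuousAt.eventually
      (h.isOpen.mem_nhds hu')
  have hWs : ContDiffAt ℝ ∞ W 0 :=
    (h.smooth.contDiffAt (h.isOpen.mem_nhds hu')).comp (0 : ℝ)
      (f := fun s : ℝ => (u + s, (0 : ℝ))) (by fun_prop)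
  have hWC : ∀ᶠ s in 𝓝 (0 : ℝ), ∃ m ∈ E.criminant, Represents (W s) m := by
    filter_upwards [hmem] with s hs
    have h1 := represents_mk (w (u + s, 0)).1 (h.direction_ne_zero hs)
    exact ⟨_, h.mem_criminant hs h1, h1⟩
  have hWd : deriv W 0 = fderiv ℝ w (u, 0) (1, 0) := by
    have h1 := HasFDerivAt.comp_hasDerivAt (0 : ℝ) (f := fun s : ℝ => (u + s, (0 : ℝ)))
      (h.hasFDerivAt hu') hline
    rw [add_zero] at h1
    exact h1.deriv
  have h0 := hL W hWs hWC
  have hW0 : W 0 = w (u, 0) := by simp [W]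
  rw [hWd, hW0] at h0
  obtain ⟨c, hc⟩ := exists_eq_smul_of_mul_eq_mul (h.direction_ne_zero hu) h0
  have h1 := h.fderiv_chart_apply hu (1, 0)
  rw [hc, map_smul] at h1
  simp only [mul_zero] at h1
  have h2 : c * (direction w k (u, 0)).1 = 1 := congrArg Prod.fst h1
  have h3 : c * (direction w k (u, 0)).2 = 0 := congrArg Prod.snd h1
  have hc0 : c ≠ 0 := left_ne_zero_of_mul_eq_one h2
  exact (mul_eq_zero.1 h3).resolve_left hc0

theorem direction_fst_ne_zero (h : FoldLift E N w k) (hL : IsLegendrian E.criminant) :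
    (direction w k 0).1 ≠ 0 := fun h0 =>
  h.chart_direction_ne_zero h.zero_mem (Prod.ext h0 (h.direction_snd_eq_zero hL h.zero_mem))

/-- At the fold the base point is stationary in v, so only the direction varies, and not along
itself. As the direction is horizontal there, its variation has a vertical component. -/
theorem fderiv_direction_snd_ne_zero (h : FoldLift E N w k) (hL : IsLegendrian E.criminant) :
    (fderiv ℝ (direction w k) 0 (0, 1)).2 ≠ 0 := by
  have h0 : ((0 : ℝ), (0 : ℝ)) ∈ N := h.zero_mem
  have hk : ContDiffOn ℝ ∞ (fderiv ℝ k) k.source :=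
    h.diffeo.1.fderiv_of_isOpen k.open_source (by simp)
  have hkd : HasFDerivAt (fderiv ℝ k) (fderiv ℝ (fderiv ℝ k) (w 0).1) (w 0).1 :=
    ((hk.contDiffAt (k.open_source.mem_nhds (h.mem_source _ h.zero_mem))).differentiableAt
      (by simp)).hasFDerivAt
  have h1 := (HasFDerivAt.comp (0 : ℝ × ℝ) (f := fun t => (w t).1) hkd
    (h.hasFDerivAt h.zero_mem).fst).clm_apply (h.hasFDerivAt h.zero_mem).snd
  have h2 : fderiv ℝ (direction w k) 0 (0, 1) =
      fderiv ℝ k (w 0).1 (fderiv ℝ w 0 (0, 1)).2 := by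
    have h3 : HasFDerivAt (direction w k) _ 0 := h1
    rw [h3.fderiv]
    have h4 : (fderiv ℝ w 0 (0, 1)).1 = 0 := h.fderiv_fst_eq_zero h0
    simp [h4]
  rw [h2]
  intro h3
  apply h.not_exists_smul h0
  refine ⟨(fderiv ℝ k (w 0).1 (fderiv ℝ w 0 (0, 1)).2).1 / (direction w k 0).1,
    h.diffeo.fderiv_injective (h.mem_source _ h0) ?_⟩
  rw [map_smul]
  change _ = _ • direction w k 0
  refine Prod.ext ?_ ?_
  · rw [Prod.smul_fst, smul_eq_mul, div_mul_cancel₀ _ (h.direction_fst_ne_zero hL)]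
    rfl
  · have h4 : (direction w k 0).2 = 0 := h.direction_snd_eq_zero hL h0
    rw [Prod.smul_snd, h4, smul_zero]
    exact h3

/-- In the chart `k`, the direction field is proportional to `R ∂ₓ + 2 v ∂_y` for a smooth
nonvanishing function `R`. -/
theorem exists_direction_proportional (h : FoldLift E N w k) (hL : IsLegendrian E.criminant) :
    ∃ R : ℝ × ℝ → ℝ, ContDiff ℝ ∞ R ∧ R 0 ≠ 0 ∧
      ∀ᶠ t in 𝓝 (0 : ℝ × ℝ), ∃ c : ℝ, direction w k t = c • ((R t, 2 * t.2) : Plane) := by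
  let U : Set (ℝ × ℝ) := N ∩ {t | (direction w k t).1 ≠ 0}
  have hU : IsOpen U :=
    h.direction_smooth.continuousOn.fst.isOpen_inter_preimage h.isOpen isOpen_ne
  have h0U : (0 : ℝ × ℝ) ∈ U := ⟨h.zero_mem, h.direction_fst_ne_zero hL⟩
  have hp : ContDiffOn ℝ ∞ (fun t => (direction w k t).2 / (direction w k t).1) U :=
    (h.direction_smooth.snd.mono Set.inter_subset_left).div
      (h.direction_smooth.fst.mono Set.inter_subset_left) fun t ht => ht.2
  obtain ⟨p, hps, hpc, hpeq⟩ := hp.exists_hasCompactSupport_eventuallyEq hU h0U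
  -- The slope p vanishes on v = 0, so it equals v q.
  obtain ⟨q, hq, hqp⟩ := exists_contDiff_sub_eq_mul hps hpc
  have hp' : ∀ᶠ t in 𝓝 (0 : ℝ × ℝ), (direction w k t).2 = p t * (direction w k t).1 := by
    filter_upwards [hpeq, hU.mem_nhds h0U] with t ht htU
    rw [ht, div_mul_cancel₀ _ htU.2]
  have hax : ∀ᶠ t in 𝓝 (0 : ℝ × ℝ), p (t.1, 0) = 0 := by
    have h1 : Filter.Tendsto (fun t : ℝ × ℝ => (t.1, (0 : ℝ))) (𝓝 0) (𝓝 (0 : ℝ × ℝ)) :=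
      (by fun_prop : Continuous fun t : ℝ × ℝ => (t.1, (0 : ℝ))).tendsto 0
    filter_upwards [h1.eventually hpeq, h1.eventually (hU.mem_nhds h0U)] with t ht htU
    rw [ht, h.direction_snd_eq_zero hL htU.1, zero_div]
  have hdir : ∀ᶠ t in 𝓝 (0 : ℝ × ℝ),
      (direction w k t).2 = t.2 * q t * (direction w k t).1 := by
    filter_upwards [hp', hax] with t ht hta
    have h1 := hqp t.1 t.2
    rw [hta, sub_zero] at h1
    rw [ht, ← h1]
  have hq0 : q 0 ≠ 0 := by
    intro hq0
    apply h.fderiv_direction_snd_ne_zero hL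
    have hD : HasFDerivAt (direction w k) (fderiv ℝ (direction w k) 0) 0 :=
      ((h.direction_smooth.contDiffAt (h.isOpen.mem_nhds h.zero_mem)).differentiableAt
        (by simp)).hasFDerivAt
    have hqd : HasFDerivAt q (fderiv ℝ q 0) 0 := (hq.differentiable (by simp) 0).hasFDerivAt
    have h1 := ((hasFDerivAt_snd (𝕜 := ℝ) (p := (0 : ℝ × ℝ))).mul hqd).mul hD.fst
    have h2 := hD.snd.unique (h1.congr_of_eventuallyEq hdir)
    have h3 := DFunLike.congr_fun h2 (0, 1)
    simpa [hq0] using h3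
  have hV : IsOpen {t | q t ≠ 0} := isOpen_ne_fun hq.continuous continuous_const
  -- With R = 2/q, (R, 2v) is proportional to (1, v q) and is the image of R ∂ᵤ + ∂ᵥ under the fold.
  have hR : ContDiffOn ℝ ∞ (fun t => 2 / q t) {t | q t ≠ 0} :=
    contDiffOn_const.div hq.contDiffOn fun t ht => ht
  obtain ⟨R, hRs, -, hReq⟩ := hR.exists_hasCompactSupport_eventuallyEq hV hq0
  refine ⟨R, hRs, ?_, ?_⟩
  · rw [hReq.self_of_nhds]
    exact div_ne_zero two_ne_zero hq0
  · filter_upwards [hReq, hdir, hV.mem_nhds hq0] with t ht htd htq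
    have htq' : q t ≠ 0 := htq
    refine ⟨(direction w k t).1 * q t / 2, Prod.ext ?_ ?_⟩
    · simp only [Prod.smul_fst, smul_eq_mul, ht]
      field_simp
    · simp only [Prod.smul_snd, smul_eq_mul, htd]
      ring

end FoldLift

/-! ### Reduction to the normal form -/

/-- A diffeomorphism that takes the parametrization `(X, V) ↦ (X, V ^ 2, [1 : V])` of the surface
`p ^ 2 = y` to a given one, up to the change of parameters `t ↦ (A t, B t)`. -/
theorem FoldLift.exists_diffeo {E : ImplicitODE} {N : Set (ℝ × ℝ)} {w : ℝ × ℝ → Plane × Plane}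
    {k : OpenPartialHomeomorph Plane Plane} (h : FoldLift E N w k)
    (hL : IsLegendrian E.criminant) :
    ∃ (φ : OpenPartialHomeomorph Plane Plane) (A B : ℝ × ℝ → ℝ), IsSmoothDiffeo φ ∧
      Filter.map (fun t => (A t, B t)) (𝓝 (0 : ℝ × ℝ)) = 𝓝 0 ∧ A 0 = 0 ∧ B 0 = 0 ∧
      ∀ᶠ t in 𝓝 (0 : ℝ × ℝ), t ∈ N ∧ (A t, B t ^ 2) ∈ φ.source ∧
        φ (A t, B t ^ 2) = (w t).1 ∧
        ∃ c : ℝ, c • fderiv ℝ φ (A t, B t ^ 2) (1, B t) = (w t).2 := by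
  obtain ⟨R, hR, hR0, hdir⟩ := h.exists_direction_proportional hL
  obtain ⟨Ψ, B, hΨs, hΨs', h0Ψ, hΨ0, hB0, hΨB, hΨR, hmap⟩ := exists_fold_straightening hR hR0
  have hΨ : IsSmoothDiffeo Ψ := ⟨hΨs, hΨs'⟩
  have hkΨ : IsSmoothDiffeo (k.trans Ψ) := h.diffeo.trans hΨ
  refine ⟨(k.trans Ψ).symm, fun t => (Ψ (t.1, t.2 ^ 2)).1, B, hkΨ.symm, hmap, ?_, hB0, ?_⟩
  · have h1 : (((0 : ℝ × ℝ).1, (0 : ℝ × ℝ).2 ^ 2) : ℝ × ℝ) = 0 := by ext <;> simp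
    exact (congrArg (fun q => (Ψ q).1) h1).trans (congrArg Prod.fst hΨ0)
  have hsrc : ∀ᶠ t in 𝓝 (0 : ℝ × ℝ), (t.1, t.2 ^ 2) ∈ Ψ.source := by
    have h1 : Filter.Tendsto (fun t : ℝ × ℝ => (t.1, t.2 ^ 2)) (𝓝 0) (𝓝 (0 : ℝ × ℝ)) := by
      have h2 := (by fun_prop : Continuous fun t : ℝ × ℝ => (t.1, t.2 ^ 2)).tendsto 0
      convert h2 using 2
      ext <;> simp
    exact h1.eventually (Ψ.open_source.mem_nhds h0Ψ)
  filter_upwards [hdir, hΨR, hsrc, h.isOpen.mem_nhds h.zero_mem] with t ⟨c, hc⟩ htR ht htN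
  have hz : (w t).1 ∈ (k.trans Ψ).source := by
    rw [OpenPartialHomeomorph.trans_source]
    refine ⟨h.mem_source t htN, ?_⟩
    rw [Set.mem_preimage, h.fold t htN]
    exact ht
  have hval : (k.trans Ψ) (w t).1 = ((Ψ (t.1, t.2 ^ 2)).1, B t ^ 2) := by
    rw [OpenPartialHomeomorph.coe_trans, Function.comp_apply, h.fold t htN]
    exact Prod.ext rfl (hΨB t)
  rw [← hval]
  refine ⟨htN, (k.trans Ψ).map_source hz, (k.trans Ψ).left_inv hz, ?_⟩
  -- In the final coordinates the direction of the equation is [1 : B], over a point with second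
  -- coordinate B².
  have hderiv : fderiv ℝ (k.trans Ψ) (w t).1 (w t).2 =
      (c * (fderiv ℝ Ψ (t.1, t.2 ^ 2) (R t, 2 * t.2)).1) • ((1 : ℝ), B t) := by
    have h1 : HasFDerivAt Ψ (fderiv ℝ Ψ (t.1, t.2 ^ 2)) (k (w t).1) := by
      rw [h.fold t htN]
      exact hΨ.hasFDerivAt ht
    have h2 := h1.comp (w t).1 (h.diffeo.hasFDerivAt (h.mem_source t htN))
    rw [OpenPartialHomeomorph.coe_trans, h2.fderiv, ContinuousLinearMap.comp_apply]
    change fderiv ℝ Ψ (t.1, t.2 ^ 2) (FoldLift.direction w k t) = _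
    rw [hc, map_smul]
    refine Prod.ext ?_ ?_
    · simp
    · rw [Prod.smul_snd, htR]
      simp only [Prod.smul_snd, smul_eq_mul]
      ring
  refine ⟨c * (fderiv ℝ Ψ (t.1, t.2 ^ 2) (R t, 2 * t.2)).1, ?_⟩
  rw [← map_smul, ← hderiv]
  exact hkΨ.fderiv_symm_apply hz _

theorem HasFoldAt.exists_foldLift {E : ImplicitODE} {m : ContactElement}
    (hfold : HasFoldAt E.surface m) :
    ∃ (N : Set (ℝ × ℝ)) (γ : ℝ × ℝ → ContactElement) (w : ℝ × ℝ → Plane × Plane)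
      (k : OpenPartialHomeomorph Plane Plane), FoldLift E N w k ∧ γ 0 = m ∧
      (∀ t ∈ N, Represents (w t) (γ t)) ∧ Topology.IsEmbedding (N.domRestrict γ) ∧
      ∃ V : Set ContactElement, IsOpen V ∧ γ '' N = E.surface ∩ V := by
  obtain ⟨N, γ, k, ⟨hN, h0N, hγ0, ⟨w, hw, hwγ, himm⟩, hemb, V, hV, hγN⟩, hk, hfold⟩ := hfold
  have hsurf : ∀ t ∈ N, w t ∈ E.dom ∧ E.F (w t) = 0 := fun t ht =>
    E.mem_dom_of_represents (hγN.subset (Set.mem_image_of_mem γ ht)).1 (hwγ t ht)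
  refine ⟨N, γ, w, k, ⟨hN, h0N, hw, himm, fun t ht => (hsurf t ht).1, fun t ht => (hsurf t ht).2,
    hk, fun t ht => ?_, fun t ht => ?_⟩, hγ0, hwγ, hemb, V, hV, hγN⟩
  · rw [← (hwγ t ht).1]
    exact (hfold t ht).1
  · rw [← (hwγ t ht).1]
    exact (hfold t ht).2

theorem theorem2 (E : ImplicitODE) (hM : E.IsSmoothSurface)
    (hC : IsSmoothCurve E.criminant) (hL : IsLegendrian E.criminant)
    (m : ContactElement) (hm : m ∈ E.criminant) (hfold : HasFoldAt E.surface m) :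
    E.LocallyEquivalent m quadraticLegendrianODE originElement := by
  obtain ⟨N, γ, w, k, h, hγ0, hwγ, hemb, V, hV, hγN⟩ := hfold.exists_foldLift
  obtain ⟨φ, A, B, hφ, hmap, hA0, hB0, hev⟩ := h.exists_diffeo hL
  have hprolong : ∀ {t : ℝ × ℝ} {q : ContactElement}, t ∈ N → (A t, B t ^ 2) ∈ φ.source →
      φ (A t, B t ^ 2) = (w t).1 →
      (∃ c : ℝ, c • fderiv ℝ φ (A t, B t ^ 2) (1, B t) = (w t).2) →
      Represents ((A t, B t ^ 2), (1, B t)) q → prolong φ q = γ t := by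
    rintro t q ht hsrc hval ⟨c, hc⟩ hq
    refine (hφ.represents_prolong hq hsrc).eq_of_smul (c := c) ?_
    simp only [hval, hc]
    exact hwγ t ht
  have horigin : Represents (((0 : ℝ), (0 : ℝ)), ((1 : ℝ), (0 : ℝ))) originElement :=
    represents_mk _ _
  obtain ⟨h0N, h0src, h0val, h0dir⟩ := hev.self_of_nhds
  have h0γ : prolong φ originElement = m := by
    rw [← hγ0]
    refine hprolong h0N h0src h0val h0dir ?_
    rw [hA0, hB0, zero_pow two_ne_zero]
    exact horigin
  rw [hA0, hB0, zero_pow two_ne_zero] at h0src h0val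
  refine ⟨φ, hφ, h0src, ?_, h0γ, ?_⟩
  · rw [← hγ0, (hwγ 0 h0N).1]
    exact h0val
  obtain ⟨N', hN', hN'o, h0N'⟩ := mem_nhds_iff.1 hev
  -- Because γ is an embedding, points of its image near m come only from parameters in N'; without
  -- this, distant parameters could return close to m.
  have hemb' : ∃ O : Set ContactElement, IsOpen O ∧ ∀ t ∈ N, γ t ∈ O ↔ t ∈ N' := by
    obtain ⟨O, hO, hOe⟩ := hemb.isInducing.isOpen_iff.1
      (hN'o.preimage (continuous_subtype_val : Continuous ((↑) : N → ℝ × ℝ)))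
    refine ⟨O, hO, fun t ht => ?_⟩
    exact Set.ext_iff.1 hOe ⟨t, ht⟩
  obtain ⟨O, hO, hON'⟩ := hemb'
  have hmVO : m ∈ V ∩ O := by
    rw [← hγ0]
    exact ⟨(hγN.subset (Set.mem_image_of_mem γ h0N)).2, (hON' 0 h0N).2 h0N'⟩
  let H : Plane × ℝ → Plane × Plane := fun z => (φ z.1, fderiv ℝ φ z.1 (1, z.2))
  have hH : ContinuousAt H 0 := by
    have h1 : ContinuousAt φ (0 : Plane × ℝ).1 := φ.continuousAt h0src
    have h2 : ContinuousAt (fderiv ℝ φ) (0 : Plane × ℝ).1 :=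
      (hφ.1.continuousOn_fderiv_of_isOpen φ.open_source (by simp)).continuousAt
        (φ.open_source.mem_nhds h0src)
    refine (h1.comp continuousAt_fst).prodMk ?_
    exact (h2.comp continuousAt_fst).clm_apply (by fun_prop)
  have hH0 : Represents (H 0) m := by
    rw [← h0γ]
    exact hφ.represents_prolong horigin h0src
  -- Openness of (A, B) at 0: every small pair (x, p) is attained by a parameter in N'.
  have hθ : ∀ᶠ z in 𝓝 (0 : Plane × ℝ), ∃ t ∈ N', A t = z.1.1 ∧ B t = z.2 := by
    have h1 : (fun t => (A t, B t)) '' N' ∈ 𝓝 (0 : ℝ × ℝ) := by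
      rw [← hmap]
      exact Filter.image_mem_map (hN'o.mem_nhds h0N')
    have h2 : Filter.Tendsto (fun z : Plane × ℝ => (z.1.1, z.2)) (𝓝 0) (𝓝 (0 : ℝ × ℝ)) :=
      (by fun_prop : Continuous fun z : Plane × ℝ => (z.1.1, z.2)).tendsto 0
    filter_upwards [h2.eventually h1] with z ⟨t, ht, hz⟩
    exact ⟨t, ht, congrArg Prod.fst hz, congrArg Prod.snd hz⟩
  have hsrc : ∀ᶠ z in 𝓝 (0 : Plane × ℝ), z.1 ∈ φ.source :=
    (continuous_fst : Continuous (Prod.fst : Plane × ℝ → Plane)).continuousAt.eventually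
      (φ.open_source.mem_nhds h0src)
  have hS := hθ.and (hsrc.and (eventually_mem_of_represents hH hH0 (hV.inter hO) hmVO))
  filter_upwards [eventually_originElement_exists_represents hS] with q hq
  obtain ⟨z, ⟨⟨t, ht, htA, htB⟩, hzs, hzO⟩, hzq⟩ := hq
  constructor
  · intro hqs
    obtain ⟨x, v, hxv⟩ := mem_quadraticLegendrianODE_surface_iff.1 hqs
    obtain ⟨c, -, hc⟩ := hxv.exists_smul hzq
    have hc2 := congrArg Prod.snd hc
    have hc1 : c = 1 := by simpa using (congrArg Prod.fst hc2).symm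
    have hv : z.2 = v := by simpa [hc1] using congrArg Prod.snd hc2
    have hz1 : z.1 = (x, v ^ 2) := congrArg Prod.fst hc
    obtain ⟨htN, hts, htv, htd⟩ := hN' ht
    have hq' : Represents ((A t, B t ^ 2), (1, B t)) q := by
      rw [htA, htB, hz1, hv]
      exact hxv
    rw [hprolong htN hts htv htd hq']
    exact (hγN.subset (Set.mem_image_of_mem γ htN)).1
  -- The image of q is some γ s with s in N', which is also the image of the element (A s, B s², [1
  -- : B s]) of the model surface. Injectivity of the prolongation identifies q with that element.
  · intro hqs
    have hq1 := hφ.represents_prolong hzq hzs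
    obtain ⟨hqV, hqO⟩ := hzO _ hq1
    obtain ⟨s, hsN, hs⟩ := hγN.superset ⟨hqs, hqV⟩
    have hsN' : s ∈ N' := (hON' s hsN).1 (hs ▸ hqO)
    obtain ⟨-, hss, hsv, hsd⟩ := hN' hsN'
    have hrep := represents_mk (A s, B s ^ 2) (v := (1, B s)) (by simp)
    have h1 := hprolong hsN hss hsv hsd hrep
    have h2 := hφ.prolong_injOn (hzq.1 ▸ hzs) hss (hs.symm.trans h1.symm)
    exact mem_quadraticLegendrianODE_surface_iff.2 ⟨_, _, h2 ▸ hrep⟩
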